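/- Setting. Let $-\infty\le t_0<t_1\le\infty$ and $0\le r_0<r_1\le\infty$, let $B=(t_0,t_1)\times(r_0,r_1)$ with coordinates $(t,r)$, let $X=B\times\mathbf S^2$, and let $d\sigma^2$ be the metric of the unit sphere $\mathbf S^2$. We say that $X$ with a metric $\bar{\mathbf g}$ is a spherically symmetric space-time if $\bar{\mathbf g}$ is a smooth Lorentzian metric (index $1$), the rotation group $SO(3)$ acting on the factor $\mathbf S^2$ acts by isometries, each sphere $\{(t,r)\}\times\mathbf S^2$ is a round sphere of curvature $1/r^2$ (that is, $\bar{\mathbf g}$ restricts to $r^2d\sigma^2$ on it), and the coordinates $t,r$ are orthogonal with $\partial/\partial t$ time-like. Let $T_SX\subset TX$ be the bundle of vectors tangent to these spheres, $T_RX$ its orthogonal complement, and $\bar{\mathbf g}_S,\bar{\mathbf g}_R$ the parts of $\bar{\mathbf g}$ on $T_SX$ and $T_RX$ (each extended by zero on the other summand). The stress-energy tensor $\mathbf T$ of $\bar{\mathbf g}$ is given by Einstein's equation $\mathrm{Ric}-\tfrac12 S\,\bar{\mathbf g}=8\pi\mathbf T$, where $S$ is the scalar curvature. Theorem 1. (a)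 Let $X$ with metric $\bar{\mathbf g}$ be a spherically symmetric space-time with $\mathbf T=-\mu\,\bar{\mathbf g}_R+\lambda\,\bar{\mathbf g}_S$ for functions $\mu,\lambda:X\to\mathbb R$. Then $\mu=\mu(r)$ is a smooth function of $r$ alone, $$\lambda=-\mu-\frac r2\,\mu_r,$$ and there exist $c\in\mathbb R$ and $r_*\in(r_0,r_1)$ such that $$\int_{r_*}^r4\pi x^2\mu(x)\,dx<\frac{r+c}{2}\qquad\text{for all } r\in(r_0,r_1),\tag{1}$$ and there exists a time coordinate $\tau$ on $B$ (a smooth function such that $(\tau,r)$ is a diffeomorphism of $B$ onto a rectangle $(\tau_0,\tau_1)\times(r_0,r_1)$, with $\partial\tau/\partial t>0$) such that $\bar{\mathbf g}$ has the static form $$\bar{\mathbf g}=-h(r)\,d\tau^2+h(r)^{-1}dr^2+r^2d\sigma^2,\qquad h(r)=\frac{r+c}{r}-\frac2r\int_{r_*}^r4\pi x^2\mu(x)\,dx.\tag{2}$$ (b) Conversely, let $\mu$ be a smooth function on $(r_0,r_1)$, $c\in\mathbb R$ and $r_*\in(r_0,r_1)$ such that (1) holds, and let $X$ carry the metric $\bar{\mathbf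 g}$ given by (2), where $\tau=t$ is the first coordinate of $B$. Then $X$ with $\bar{\mathbf g}$ is a spherically symmetric space-time, and its stress-energy tensor is $\mathbf T=-\mu\,\bar{\mathbf g}_R+\lambda\,\bar{\mathbf g}_S$ with $\lambda=-\mu-\frac r2\mu_r$. -/

import Mathlib

open scoped Manifold ContDiff

noncomputable section

namespace SphericalSpacetime

/-! ### Curvature of a semi-Riemannian metric -/

section Local

variable {E : Type*} [NormedAddCommGroup E] [NormedSpace ℝ E]
  {ι : Type*} [Fintype ι] [DecidableEq ι]

/-- The partial derivative of `f` at `u` in the direction of the basis vector `b j`. -/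
def partialDeriv (b : Module.Basis ι ℝ E) (j : ι) (f : E → ℝ) (u : E) : ℝ :=
  fderiv ℝ f u (b j)

/-- The Christoffel symbol `Γ^i_{jk}` of the metric with component matrix `G`. -/
def christoffel (b : Module.Basis ι ℝ E) (G : E → Matrix ι ι ℝ) (i j k : ι) (u : E) : ℝ :=
  (1 / 2) * ∑ l, (G u)⁻¹ i l *
    (partialDeriv b j (fun y => G y k l) u + partialDeriv b k (fun y => G y j l) u
      - partialDeriv b l (fun y => G y j k) u)

/-- The component `R_{jk}` of the Ricci tensor of the metric with component matrix `G`
(the sign is such that round spheres have positive Ricci curvature). -/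
def ricciComp (b : Module.Basis ι ℝ E) (G : E → Matrix ι ι ℝ) (j k : ι) (u : E) : ℝ :=
  ∑ i, (partialDeriv b i (christoffel b G i j k) u - partialDeriv b k (christoffel b G i i j) u)
    + ∑ i, ∑ p, (christoffel b G i i p u * christoffel b G p j k u
        - christoffel b G i k p u * christoffel b G p i j u)

/-- The scalar curvature of the metric with component matrix `G`. -/
def scalarComp (b : Module.Basis ι ℝ E) (G : E → Matrix ι ι ℝ) (u : E) : ℝ :=
  ∑ j, ∑ k, (G u)⁻¹ j k * ricciComp b G j k u

end Local

section Manifold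

variable {E : Type*} [NormedAddCommGroup E] [NormedSpace ℝ E]
  {H : Type*} [TopologicalSpace H] {I : ModelWithCorners ℝ E H}
  {M : Type*} [TopologicalSpace M] [ChartedSpace H M]
  {ι : Type*} [Fintype ι] [DecidableEq ι]

/-- The component matrix `G_{ij}(u)` of `g` in the chart around `x`, with respect to the linear
coordinates that `b` gives on the model space. -/
def chartMatrix (b : Module.Basis ι ℝ E) (g : ∀ x : M, LinearMap.BilinForm ℝ (TangentSpace I x))
    (x : M) (u : E) : Matrix ι ι ℝ :=
  Matrix.of fun i j =>
    g ((extChartAt I x).symm u)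
      (mfderiv 𝓘(ℝ, E) I (extChartAt I x).symm u (b i))
      (mfderiv 𝓘(ℝ, E) I (extChartAt I x).symm u (b j))

/-- `g` is smooth at `x`: its components in the chart around `x` are. -/
def SmoothMetricAt (b : Module.Basis ι ℝ E)
    (g : ∀ x : M, LinearMap.BilinForm ℝ (TangentSpace I x)) (x : M) : Prop :=
  ∀ i j, ContDiffAt ℝ ∞ (fun u => chartMatrix b g x u i j) (extChartAt I x x)

/-- The Ricci tensor of `g`, computed in the chart around `x`. -/
def ricci (b : Module.Basis ι ℝ E) (g : ∀ x : M, LinearMap.BilinForm ℝ (TangentSpace I x))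
    (x : M) (v w : TangentSpace I x) : ℝ :=
  ∑ j, ∑ k, ricciComp b (chartMatrix b g x) j k (extChartAt I x x)
    * b.repr (mfderiv I 𝓘(ℝ, E) (extChartAt I x) x v) j
    * b.repr (mfderiv I 𝓘(ℝ, E) (extChartAt I x) x w) k

/-- The scalar curvature of `g`. -/
def scalarCurvature (b : Module.Basis ι ℝ E)
    (g : ∀ x : M, LinearMap.BilinForm ℝ (TangentSpace I x)) (x : M) : ℝ :=
  scalarComp b (chartMatrix b g x) (extChartAt I x x)

/-- The stress-energy tensor `T` that Einstein's equation `Ric - (1/2) S g = 8 π T` assigns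
to the metric `g`. -/
def stressEnergy (b : Module.Basis ι ℝ E)
    (g : ∀ x : M, LinearMap.BilinForm ℝ (TangentSpace I x))
    (x : M) (v w : TangentSpace I x) : ℝ :=
  (8 * Real.pi)⁻¹ * (ricci b g x v w - (1 / 2) * scalarCurvature b g x * g x v w)

end Manifold

/-- A Lorentzian scalar product: symmetric, nondegenerate, of index one. That is, there is a
timelike vector whose orthogonal complement is positive definite. -/
def IsLorentzian {V : Type*} [AddCommGroup V] [Module ℝ V] (B : LinearMap.BilinForm ℝ V) : Prop :=
  (∀ v w, B v w = B w v) ∧ ∃ v, B v v < 0 ∧ ∀ w, w ≠ 0 → B v w = 0 → 0 < B w w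

/-! ### The manifold `B × S²` -/

/-- Euclidean 3-space. -/
abbrev E3 : Type := EuclideanSpace ℝ (Fin 3)

instance : Fact (Module.finrank ℝ E3 = 2 + 1) := ⟨by simp⟩

/-- The unit 2-sphere. -/
abbrev S2 : Type := Metric.sphere (0 : E3) 1

/-- The 4-manifold `ℝ² × S²`, with points `((t, r), σ)`. The space-times below are its open
subsets `B × S²`, where `B` is a rectangle; values of tensors outside play no role. -/
abbrev Ambient : Type := (ℝ × ℝ) × S2

/-- The model with corners of `ℝ² × S²`. -/
abbrev J : ModelWithCorners ℝ ((ℝ × ℝ) × EuclideanSpace ℝ (Fin 2))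
    (ModelProd (ℝ × ℝ) (EuclideanSpace ℝ (Fin 2))) :=
  𝓘(ℝ, ℝ × ℝ).prod (𝓡 2)

/-- The standard basis of the model space of `ℝ² × S²`. -/
def stdBasis : Module.Basis (Fin 2 ⊕ Fin 2) ℝ ((ℝ × ℝ) × EuclideanSpace ℝ (Fin 2)) :=
  (Module.Basis.finTwoProd ℝ).prod (EuclideanSpace.basisFun (Fin 2) ℝ).toBasis

/-- A field of bilinear forms on the tangent spaces of `ℝ² × S²`. -/
abbrev MetricField : Type := ∀ x : Ambient, LinearMap.BilinForm ℝ (TangentSpace J x)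

/-- The real open interval with (possibly infinite) end points `a` and `b`. -/
def openInterval (a b : EReal) : Set ℝ := {s | a < (s : EReal) ∧ (s : EReal) < b}

/-- The rectangle `B = (t₀, t₁) × (r₀, r₁)`. -/
def rectangle (t₀ t₁ r₀ r₁ : EReal) : Set (ℝ × ℝ) :=
  openInterval t₀ t₁ ×ˢ openInterval r₀ r₁

/-- The manifold `X = B × S²`, where `B` is the rectangle `(t₀, t₁) × (r₀, r₁)`. -/
def spaceTime (t₀ t₁ r₀ r₁ : EReal) : Set Ambient :=
  {x | x.1 ∈ rectangle t₀ t₁ r₀ r₁}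

/-- The function `r` on `X`. -/
def radius (x : Ambient) : ℝ := x.1.2

/-- The differential at `x` of a function on `B`, pulled back to `X`. -/
def dBase (f : ℝ × ℝ → ℝ) (x : Ambient) (v : TangentSpace J x) : ℝ :=
  mfderiv J 𝓘(ℝ, ℝ) (fun y : Ambient => f y.1) x v

/-- The differential at `x` of the map `((t, r), σ) ↦ σ` into `ℝ³`. -/
def dSphere (x : Ambient) (v : TangentSpace J x) : E3 :=
  mfderiv J 𝓘(ℝ, E3) (fun y : Ambient => (y.2 : E3)) x v

/-- The metric `dσ²` that the unit sphere inherits from `ℝ³`, pulled back to `X`. -/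
def dSigmaSq (x : Ambient) (v w : TangentSpace J x) : ℝ :=
  inner ℝ (dSphere x v) (dSphere x w)

/-- The coordinate vector `∂/∂t` at `x`. -/
def coordT (x : Ambient) : TangentSpace J x :=
  (((1, 0), 0) : (ℝ × ℝ) × EuclideanSpace ℝ (Fin 2))

/-- The coordinate vector `∂/∂r` at `x`. -/
def coordR (x : Ambient) : TangentSpace J x :=
  (((0, 1), 0) : (ℝ × ℝ) × EuclideanSpace ℝ (Fin 2))

/-- The fibre at `x` of `T_S X`: the vectors tangent to the sphere through `x`. -/
def tangentS (x : Ambient) : Set (TangentSpace J x) :=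
  {s | mfderiv J 𝓘(ℝ, ℝ × ℝ) (fun y : Ambient => y.1) x s = 0}

/-- The fibre at `x` of `T_R X`: the orthogonal complement of `T_S X` with respect to `g`. -/
def tangentR (g : MetricField) (x : Ambient) : Set (TangentSpace J x) :=
  {v | ∀ s ∈ tangentS x, g x v s = 0}

/-- The action of an orthogonal transformation of `ℝ³` on the sphere factor. -/
def rotate (A : E3 ≃ₗᵢ[ℝ] E3) (x : Ambient) : Ambient :=
  (x.1, ⟨A x.2, by simp⟩)

/-- `X = (t₀, t₁) × (r₀, r₁) × S²` with the metric `g` is a spherically symmetric space-time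
(with coordinates `t`, `r` on the orbit space). -/
structure IsSphericallySymmetric (t₀ t₁ r₀ r₁ : EReal) (g : MetricField) : Prop where
  /-- `g` is smooth. -/
  smooth : ∀ x ∈ spaceTime t₀ t₁ r₀ r₁, SmoothMetricAt stdBasis g x
  /-- `g` is a Lorentzian metric. -/
  lorentzian : ∀ x ∈ spaceTime t₀ t₁ r₀ r₁, IsLorentzian (g x)
  /-- The rotation group `SO(3)`, acting on the factor `S²`, acts by isometries. -/
  invariant : ∀ A : E3 ≃ₗᵢ[ℝ] E3, LinearMap.det (A.toLinearEquiv : E3 →ₗ[ℝ] E3) = 1 →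
    ∀ x ∈ spaceTime t₀ t₁ r₀ r₁, ∀ v w : TangentSpace J x,
      g (rotate A x) (mfderiv J J (rotate A) x v) (mfderiv J J (rotate A) x w) = g x v w
  /-- The orbit through `x` is a round sphere of radius `r`, that is, of curvature `1 / r²`. -/
  round : ∀ x ∈ spaceTime t₀ t₁ r₀ r₁, ∀ s ∈ tangentS x, ∀ s' ∈ tangentS x,
    g x s s' = radius x ^ 2 * dSigmaSq x s s'
  /-- The coordinates `t` and `r` are orthogonal. -/
  orthogonal : ∀ x ∈ spaceTime t₀ t₁ r₀ r₁, g x (coordT x) (coordR x) = 0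
  /-- `t` is a time coordinate. -/
  timelike : ∀ x ∈ spaceTime t₀ t₁ r₀ r₁, g x (coordT x) (coordT x) < 0

/-- The stress-energy tensor of `g` is `T = -μ g_R + lam g_S` on `X`, where `g_R` and `g_S` are
the parts of `g` on `T_R X` and `T_S X`. -/
def HasStressEnergy (t₀ t₁ r₀ r₁ : EReal) (g : MetricField) (μ lam : Ambient → ℝ) : Prop :=
  ∀ x ∈ spaceTime t₀ t₁ r₀ r₁, ∀ v ∈ tangentR g x, ∀ v' ∈ tangentR g x,
    ∀ s ∈ tangentS x, ∀ s' ∈ tangentS x,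
      stressEnergy stdBasis g x (v + s) (v' + s') = -μ x * g x v v' + lam x * g x s s'

/-- `τ` is a time coordinate on `B = (t₀, t₁) × (r₀, r₁)`, with the same time orientation as `t`:
`(τ, r)` maps `B` diffeomorphically onto the rectangle `(τ₀, τ₁) × (r₀, r₁)`. -/
structure IsTimeCoordinate (t₀ t₁ r₀ r₁ τ₀ τ₁ : EReal) (τ : ℝ × ℝ → ℝ) : Prop where
  smooth : ContDiffOn ℝ ∞ τ (rectangle t₀ t₁ r₀ r₁)
  regular : ∀ p ∈ rectangle t₀ t₁ r₀ r₁, 0 < fderiv ℝ τ p (1, 0)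
  bijOn : Set.BijOn (fun p => (τ p, p.2)) (rectangle t₀ t₁ r₀ r₁) (rectangle τ₀ τ₁ r₀ r₁)

/-- On `X`, `g = -h(r) dτ² + h(r)⁻¹ dr² + r² dσ²`. -/
def HasStaticForm (t₀ t₁ r₀ r₁ : EReal) (g : MetricField) (h : ℝ → ℝ) (τ : ℝ × ℝ → ℝ) : Prop :=
  ∀ x ∈ spaceTime t₀ t₁ r₀ r₁, ∀ v w : TangentSpace J x,
    g x v w = -h (radius x) * (dBase τ x v * dBase τ x w)
      + (h (radius x))⁻¹ * (dBase Prod.snd x v * dBase Prod.snd x w)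
      + radius x ^ 2 * dSigmaSq x v w

/-- The integral `∫_{r_*}^r 4 π x² m(x) dx`. -/
def massIntegral (m : ℝ → ℝ) (rs r : ℝ) : ℝ :=
  ∫ x in rs..r, 4 * Real.pi * x ^ 2 * m x

/-- The function `h(r) = (r + c) / r - (2 / r) ∫_{r_*}^r 4 π x² m(x) dx`. -/
def hFun (m : ℝ → ℝ) (c rs r : ℝ) : ℝ :=
  (r + c) / r - 2 / r * massIntegral m rs r

end SphericalSpacetime

end

open SphericalSpacetime

noncomputable section

namespace SphericalSpacetime

section PartialDeriv

variable {ι E : Type*} [NormedAddCommGroup E] [NormedSpace ℝ E]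

lemma partialDeriv_congr {b : Module.Basis ι ℝ E} {j : ι} {f f' : E → ℝ} {u : E}
    (h : f =ᶠ[nhds u] f') : partialDeriv b j f u = partialDeriv b j f' u := by
  simp only [partialDeriv, h.fderiv_eq]

lemma contDiffOn_partialDeriv {b : Module.Basis ι ℝ E} {j : ι} {f : E → ℝ} {U : Set E}
    (hU : IsOpen U) (hf : ContDiffOn ℝ ∞ f U) : ContDiffOn ℝ ∞ (partialDeriv b j f) U :=
  (hf.fderiv_of_isOpen hU (by simp)).clm_apply contDiffOn_const

end PartialDeriv

/-! ### The Ricci tensor of a diagonal metric -/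

section Diagonal

variable {ι : Type*} [Fintype ι] [DecidableEq ι]

/-- `Γ_{ijk}` (up to the factor `1 / 2`) of a diagonal metric, where `e i j` is the derivative of
the `i`-th diagonal entry in the direction `j`. -/
def diagFirstKind (e : ι → ι → ℝ) (i j k : ι) : ℝ :=
  (if k = i then e i j else 0) + (if j = i then e i k else 0) - (if j = k then e j i else 0)

/-- The Christoffel symbol `Γ^i_{jk}` of a diagonal metric with entries `d` and first
derivatives `e`. -/
def diagChristoffel (d : ι → ℝ) (e : ι → ι → ℝ) (i j k : ι) : ℝ :=
  (1 / 2) * ((d i)⁻¹ * diagFirstKind e i j k)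

/-- The derivative of `Γ^i_{jk}` in the direction `l` for a diagonal metric with entries `d`,
first derivatives `e` and second derivatives `e'`. -/
def diagChristoffelDeriv (d : ι → ℝ) (e : ι → ι → ℝ) (e' : ι → ι → ι → ℝ) (l i j k : ι) : ℝ :=
  (1 / 2) * ((d i)⁻¹ * diagFirstKind (fun a b => e' a b l) i j k
    - e i l / d i ^ 2 * diagFirstKind e i j k)

/-- The Ricci tensor of a diagonal metric in terms of the derivatives of its entries. -/
def diagRicci (d : ι → ℝ) (e : ι → ι → ℝ) (e' : ι → ι → ι → ℝ) (j k : ι) : ℝ :=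
  ∑ i, (diagChristoffelDeriv d e e' i i j k - diagChristoffelDeriv d e e' k i i j)
    + ∑ i, ∑ p, (diagChristoffel d e i i p * diagChristoffel d e p j k
        - diagChristoffel d e i k p * diagChristoffel d e p i j)

variable {E : Type*} [NormedAddCommGroup E] [NormedSpace ℝ E]

lemma christoffel_of_diagonal (b : Module.Basis ι ℝ E) {G : E → Matrix ι ι ℝ} {d : ι → E → ℝ}
    {U : Set E} (hU : IsOpen U) (hG : ∀ y ∈ U, G y = Matrix.diagonal fun i => d i y)
    (hd : ∀ i, ∀ y ∈ U, d i y ≠ 0) {u : E} (hu : u ∈ U) (i j k : ι) :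
    christoffel b G i j k u
      = diagChristoffel (fun i => d i u) (fun i j => partialDeriv b j (d i) u) i j k := by
  have hinv : (G u)⁻¹ = Matrix.diagonal fun i => (d i u)⁻¹ := by
    rw [hG u hu]
    apply Matrix.inv_eq_right_inv
    rw [Matrix.diagonal_mul_diagonal, ← Matrix.diagonal_one]
    congr 1
    ext i
    exact mul_inv_cancel₀ (hd i u hu)
  have hpd : ∀ l m n, partialDeriv b l (fun y => G y m n) u
      = if m = n then partialDeriv b l (d m) u else 0 := by
    intro l m n
    have h1 : (fun y => G y m n) =ᶠ[nhds u] fun y => if m = n then d m y else 0 := by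
      filter_upwards [hU.mem_nhds hu] with y hy
      rw [hG y hy, Matrix.diagonal_apply]
    rw [partialDeriv_congr h1]
    split_ifs
    · rfl
    · simp [partialDeriv]
  simp only [christoffel, hinv, hpd, diagChristoffel, diagFirstKind]
  congr 1
  rw [Finset.sum_eq_single i]
  · simp only [Matrix.diagonal_apply_eq]
    congr 1
    by_cases hki : k = i
    · subst hki
      by_cases hjk : j = k
      · subst hjk; simp
      · simp [hjk]
    · by_cases hji : j = i
      · subst hji; simp [hki, Ne.symm hki]
      · simp [hki, hji]
  · intro l _ hl
    rw [Matrix.diagonal_apply_ne _ hl.symm, zero_mul]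
  · simp

lemma hasFDerivAt_ite {f : E → ℝ} {u : E} (P : Prop) [Decidable P] (hf : DifferentiableAt ℝ f u) :
    HasFDerivAt (fun y => if P then f y else 0) (if P then fderiv ℝ f u else 0) u := by
  split_ifs
  · exact hf.hasFDerivAt
  · exact hasFDerivAt_const _ _

lemma ricciComp_of_diagonal (b : Module.Basis ι ℝ E) {G : E → Matrix ι ι ℝ} {d : ι → E → ℝ}
    {U : Set E} (hU : IsOpen U) (hG : ∀ y ∈ U, G y = Matrix.diagonal fun i => d i y)
    (hd : ∀ i, ∀ y ∈ U, d i y ≠ 0) (hs : ∀ i, ContDiffOn ℝ ∞ (d i) U) {u : E} (hu : u ∈ U)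
    (j k : ι) :
    ricciComp b G j k u
      = diagRicci (fun i => d i u) (fun i j => partialDeriv b j (d i) u)
          (fun i j k => partialDeriv b k (partialDeriv b j (d i)) u) j k := by
  have hder : ∀ l i j k, partialDeriv b l (christoffel b G i j k) u
      = diagChristoffelDeriv (fun i => d i u) (fun i j => partialDeriv b j (d i) u)
          (fun i j k => partialDeriv b k (partialDeriv b j (d i)) u) l i j k := by
    intro l i j k
    have h1 : christoffel b G i j k =ᶠ[nhds u] fun y =>
        diagChristoffel (fun i => d i y) (fun i j => partialDeriv b j (d i) y) i j k := by
      filter_upwards [hU.mem_nhds hu] with y hy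
      exact christoffel_of_diagonal b hU hG hd hy i j k
    have hdiff : ∀ m, DifferentiableAt ℝ (d m) u := fun m =>
      ((hs m).contDiffAt (hU.mem_nhds hu)).differentiableAt (by simp)
    have hdiff' : ∀ m n, DifferentiableAt ℝ (partialDeriv b n (d m)) u := fun m n =>
      ((contDiffOn_partialDeriv hU (hs m)).contDiffAt (hU.mem_nhds hu)).differentiableAt (by simp)
    have h2 := (((hasFDerivAt_ite (k = i) (hdiff' i j)).add
      (hasFDerivAt_ite (j = i) (hdiff' i k))).sub (hasFDerivAt_ite (j = k) (hdiff' j i)))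
    have h3 := (((hasFDerivAt_inv (hd i u hu)).comp u (hdiff i).hasFDerivAt).mul h2).const_mul (1 / 2 : ℝ)
    rw [partialDeriv_congr h1, partialDeriv]
    have h4 : (fun y => diagChristoffel (fun i => d i y) (fun i j => partialDeriv b j (d i) y) i j k)
      = fun y => (1 / 2 : ℝ) * ((d i y)⁻¹ * (((if k = i then partialDeriv b j (d i) y else 0)
        + (if j = i then partialDeriv b k (d i) y else 0))
        - (if j = k then partialDeriv b i (d j) y else 0))) := by
      ext y; simp [diagChristoffel, diagFirstKind]
    rw [h4]
    erw [h3.fderiv]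
    simp only [diagChristoffelDeriv, diagFirstKind, smul_apply,
      add_apply, sub_apply, smul_eq_mul, partialDeriv,
      apply_ite (fun L : E →L[ℝ] ℝ => L (b l)),
      zero_apply]
    simp
    ring
  simp only [ricciComp, diagRicci, hder, christoffel_of_diagonal b hU hG hd hu]

end Diagonal

/-- The entries of the diagonal metric `-A dt² + B dr² + r² dσ²` at the centre of a stereographic
chart. -/
def blockVal (A B r : ℝ) : Fin 2 ⊕ Fin 2 → ℝ :=
  Sum.elim ![-A, B] fun _ => r ^ 2

/-- The first derivatives of the entries `blockVal`, in terms of the derivatives of `A` and `B`. -/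
def blockDeriv (A₁ B₁ : Fin 2 → ℝ) (r : ℝ) : Fin 2 ⊕ Fin 2 → Fin 2 ⊕ Fin 2 → ℝ :=
  Sum.elim (fun i => Sum.elim (![-A₁, B₁] i) fun _ => 0) fun _ => Sum.elim ![0, 2 * r] fun _ => 0

/-- The second derivatives of the entries `blockVal`, in terms of those of `A` and `B`. -/
def blockDeriv₂ (A₂ B₂ : Fin 2 → Fin 2 → ℝ) (r : ℝ) :
    Fin 2 ⊕ Fin 2 → Fin 2 ⊕ Fin 2 → Fin 2 ⊕ Fin 2 → ℝ :=
  Sum.elim (fun i => Sum.elim (fun j => Sum.elim (![-A₂, B₂] i j) fun _ => 0) fun _ _ => 0)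
    fun _ => Sum.elim (fun j => Sum.elim (![![0, 0], ![0, 2]] j) fun _ => 0)
      fun a => Sum.elim (fun _ => 0) fun c => if a = c then -r ^ 2 else 0

section Block

variable {A B r : ℝ} {A₁ B₁ : Fin 2 → ℝ} {A₂ B₂ : Fin 2 → Fin 2 → ℝ}

lemma diagChristoffel_block :
    (∀ i j k : Fin 2,
      diagChristoffel (blockVal A B r) (blockDeriv A₁ B₁ r) (.inl i) (.inl j) (.inl k)
      = diagChristoffel ![-A, B] ![-A₁, B₁] i j k) ∧
    (∀ i a c : Fin 2,
      diagChristoffel (blockVal A B r) (blockDeriv A₁ B₁ r) (.inl i) (.inr a) (.inr c)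
      = (if a = c then ![0, -r / B] i else 0)) ∧
    (∀ a i c : Fin 2,
      diagChristoffel (blockVal A B r) (blockDeriv A₁ B₁ r) (.inr a) (.inl i) (.inr c)
      = (if c = a then ![0, 1 / r] i else 0)) ∧
    (∀ a c i : Fin 2,
      diagChristoffel (blockVal A B r) (blockDeriv A₁ B₁ r) (.inr a) (.inr c) (.inl i)
      = (if c = a then ![0, 1 / r] i else 0)) ∧
    (∀ a i j : Fin 2,
      diagChristoffel (blockVal A B r) (blockDeriv A₁ B₁ r) (.inr a) (.inl i) (.inl j) = 0) ∧
    (∀ i a j : Fin 2,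
      diagChristoffel (blockVal A B r) (blockDeriv A₁ B₁ r) (.inl i) (.inr a) (.inl j) = 0) ∧
    (∀ i j a : Fin 2,
      diagChristoffel (blockVal A B r) (blockDeriv A₁ B₁ r) (.inl i) (.inl j) (.inr a) = 0) ∧
    (∀ a c f : Fin 2,
      diagChristoffel (blockVal A B r) (blockDeriv A₁ B₁ r) (.inr a) (.inr c) (.inr f) = 0) := by
  simp only [diagChristoffel, diagFirstKind, blockVal, blockDeriv, Sum.elim_inl, Sum.elim_inr,
    Sum.inl.injEq, Sum.inr.injEq, reduceCtorEq, if_false, ite_self, add_zero, zero_add, sub_self,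
    mul_zero, zero_sub, sub_zero, implies_true, true_and, and_true]
  have h : ∀ x : ℝ, 1 / 2 * ((x ^ 2)⁻¹ * (2 * x)) = x⁻¹ := by
    intro x
    by_cases hx : x = 0
    · simp [hx]
    · field_simp
  refine ⟨?_, ?_, ?_⟩
  · intro i a c
    split_ifs
    · fin_cases i <;> simp; ring
    · simp
  · intro a i c
    split_ifs
    · fin_cases i
      · simp
      · simpa using h r
    · simp
  · intro a c i
    split_ifs
    · fin_cases i
      · simp
      · simpa using h r
    · simp

lemma diagChristoffelDeriv_block :
    (∀ l i j k : Fin 2,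
      diagChristoffelDeriv (blockVal A B r) (blockDeriv A₁ B₁ r) (blockDeriv₂ A₂ B₂ r)
      (.inl l) (.inl i) (.inl j) (.inl k)
      = diagChristoffelDeriv ![-A, B] ![-A₁, B₁] ![-A₂, B₂] l i j k) ∧
    (∀ l i a c : Fin 2,
      diagChristoffelDeriv (blockVal A B r) (blockDeriv A₁ B₁ r) (blockDeriv₂ A₂ B₂ r)
      (.inl l) (.inl i) (.inr a) (.inr c)
      = (if a = c then ![0, -![0, 1] l / B + r * B₁ l / B ^ 2] i else 0)) ∧
    (∀ l a i c : Fin 2,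
      diagChristoffelDeriv (blockVal A B r) (blockDeriv A₁ B₁ r) (blockDeriv₂ A₂ B₂ r)
      (.inl l) (.inr a) (.inl i) (.inr c) = (if c = a then ![0, -![0, 1] l / r ^ 2] i else 0)) ∧
    (∀ l a c i : Fin 2,
      diagChristoffelDeriv (blockVal A B r) (blockDeriv A₁ B₁ r) (blockDeriv₂ A₂ B₂ r)
      (.inl l) (.inr a) (.inr c) (.inl i) = (if c = a then ![0, -![0, 1] l / r ^ 2] i else 0)) ∧
    (∀ l a i j : Fin 2,
      diagChristoffelDeriv (blockVal A B r) (blockDeriv A₁ B₁ r) (blockDeriv₂ A₂ B₂ r)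
      (.inl l) (.inr a) (.inl i) (.inl j) = 0) ∧
    (∀ l i a j : Fin 2,
      diagChristoffelDeriv (blockVal A B r) (blockDeriv A₁ B₁ r) (blockDeriv₂ A₂ B₂ r)
      (.inl l) (.inl i) (.inr a) (.inl j) = 0) ∧
    (∀ l i j a : Fin 2,
      diagChristoffelDeriv (blockVal A B r) (blockDeriv A₁ B₁ r) (blockDeriv₂ A₂ B₂ r)
      (.inl l) (.inl i) (.inl j) (.inr a) = 0) ∧
    (∀ l a c f : Fin 2,
      diagChristoffelDeriv (blockVal A B r) (blockDeriv A₁ B₁ r) (blockDeriv₂ A₂ B₂ r)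
      (.inl l) (.inr a) (.inr c) (.inr f) = 0) ∧
    (∀ q a i j : Fin 2,
      diagChristoffelDeriv (blockVal A B r) (blockDeriv A₁ B₁ r) (blockDeriv₂ A₂ B₂ r)
      (.inr q) (.inr a) (.inl i) (.inl j) = 0) ∧
    (∀ q i a j : Fin 2,
      diagChristoffelDeriv (blockVal A B r) (blockDeriv A₁ B₁ r) (blockDeriv₂ A₂ B₂ r)
      (.inr q) (.inl i) (.inr a) (.inl j) = 0) ∧
    (∀ q i j a : Fin 2,
      diagChristoffelDeriv (blockVal A B r) (blockDeriv A₁ B₁ r) (blockDeriv₂ A₂ B₂ r)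
      (.inr q) (.inl i) (.inl j) (.inr a) = 0) ∧
    (∀ q i j k : Fin 2,
      diagChristoffelDeriv (blockVal A B r) (blockDeriv A₁ B₁ r) (blockDeriv₂ A₂ B₂ r)
      (.inr q) (.inl i) (.inl j) (.inl k) = 0) ∧
    (∀ q i a c : Fin 2,
      diagChristoffelDeriv (blockVal A B r) (blockDeriv A₁ B₁ r) (blockDeriv₂ A₂ B₂ r)
      (.inr q) (.inl i) (.inr a) (.inr c) = 0) ∧
    (∀ q a i c : Fin 2,
      diagChristoffelDeriv (blockVal A B r) (blockDeriv A₁ B₁ r) (blockDeriv₂ A₂ B₂ r)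
      (.inr q) (.inr a) (.inl i) (.inr c) = 0) ∧
    (∀ q a c i : Fin 2,
      diagChristoffelDeriv (blockVal A B r) (blockDeriv A₁ B₁ r) (blockDeriv₂ A₂ B₂ r)
      (.inr q) (.inr a) (.inr c) (.inl i) = 0) ∧
    (∀ q a c f : Fin 2,
      diagChristoffelDeriv (blockVal A B r) (blockDeriv A₁ B₁ r) (blockDeriv₂ A₂ B₂ r)
      (.inr q) (.inr a) (.inr c) (.inr f)
      = 1 / 2 * ((r ^ 2)⁻¹ * diagFirstKind (fun _ s => if s = q then -r ^ 2 else 0) a c f)) := by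
  simp only [diagChristoffelDeriv, diagFirstKind, blockVal, blockDeriv, blockDeriv₂, Sum.elim_inl,
    Sum.elim_inr, Sum.inl.injEq, Sum.inr.injEq, reduceCtorEq, if_false, ite_self, add_zero,
    zero_add, sub_self, mul_zero, zero_mul, zero_div, zero_sub, sub_zero, implies_true, true_and, and_true]
  have h : ∀ x : ℝ, 1 / 2 * ((x ^ 2)⁻¹ * 2 - 2 * x / (x ^ 2) ^ 2 * (2 * x)) = -1 / x ^ 2 := by
    intro x
    by_cases hx : x = 0
    · simp [hx]
    · field_simp; ring
  refine ⟨?_, ?_, ?_⟩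
  · intro l i a c
    split_ifs
    · fin_cases i <;> fin_cases l <;> simp <;> ring
    · simp
  · intro l a i c
    split_ifs
    · fin_cases i <;> fin_cases l <;> simp [← h]
    · simp
  · intro l a c i
    split_ifs
    · fin_cases i <;> fin_cases l <;> simp [← h]
    · simp

theorem diagRicci_block_tt (hA : A ≠ 0) (hB : B ≠ 0) (hr : r ≠ 0) :
    diagRicci (blockVal A B r) (blockDeriv A₁ B₁ r) (blockDeriv₂ A₂ B₂ r) (.inl 0) (.inl 0)
      = -B₂ 0 0 / (2 * B) + B₁ 0 ^ 2 / (4 * B ^ 2) + A₁ 0 * B₁ 0 / (4 * A * B)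
        + A₂ 1 1 / (2 * B) - A₁ 1 * B₁ 1 / (4 * B ^ 2) - A₁ 1 ^ 2 / (4 * A * B)
        + A₁ 1 / (r * B) := by
  simp only [diagRicci, Fintype.sum_sum_type, diagChristoffel_block, diagChristoffelDeriv_block]
  simp [diagChristoffel, diagChristoffelDeriv, diagFirstKind]
  field_simp
  ring

theorem diagRicci_block_rr (hA : A ≠ 0) (hB : B ≠ 0) (hr : r ≠ 0) :
    diagRicci (blockVal A B r) (blockDeriv A₁ B₁ r) (blockDeriv₂ A₂ B₂ r) (.inl 1) (.inl 1)
      = B₂ 0 0 / (2 * A) - A₁ 0 * B₁ 0 / (4 * A ^ 2) - B₁ 0 ^ 2 / (4 * A * B)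
        - A₂ 1 1 / (2 * A) + A₁ 1 ^ 2 / (4 * A ^ 2) + A₁ 1 * B₁ 1 / (4 * A * B)
        + B₁ 1 / (r * B) := by
  simp only [diagRicci, Fintype.sum_sum_type, diagChristoffel_block, diagChristoffelDeriv_block]
  simp [diagChristoffel, diagChristoffelDeriv, diagFirstKind]
  field_simp
  ring

theorem diagRicci_block_tr (hA : A ≠ 0) (hB : B ≠ 0) (hr : r ≠ 0) (hA₂ : A₂ 0 1 = A₂ 1 0) :
    diagRicci (blockVal A B r) (blockDeriv A₁ B₁ r) (blockDeriv₂ A₂ B₂ r) (.inl 0) (.inl 1)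
      = B₁ 0 / (r * B) := by
  simp only [diagRicci, Fintype.sum_sum_type, diagChristoffel_block, diagChristoffelDeriv_block]
  simp [diagChristoffel, diagChristoffelDeriv, diagFirstKind, hA₂]
  field_simp
  ring

theorem diagRicci_block_rt (hA : A ≠ 0) (hB : B ≠ 0) (hr : r ≠ 0) (hB₂ : B₂ 0 1 = B₂ 1 0) :
    diagRicci (blockVal A B r) (blockDeriv A₁ B₁ r) (blockDeriv₂ A₂ B₂ r) (.inl 1) (.inl 0)
      = B₁ 0 / (r * B) := by
  simp only [diagRicci, Fintype.sum_sum_type, diagChristoffel_block, diagChristoffelDeriv_block]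
  simp [diagChristoffel, diagChristoffelDeriv, diagFirstKind, hB₂]
  field_simp
  ring

theorem diagRicci_block_inl_inr (i a : Fin 2) :
    diagRicci (blockVal A B r) (blockDeriv A₁ B₁ r) (blockDeriv₂ A₂ B₂ r) (.inl i) (.inr a)
      = 0 := by
  simp [diagRicci, diagChristoffel_block, diagChristoffelDeriv_block]

theorem diagRicci_block_inr_inl (i a : Fin 2) :
    diagRicci (blockVal A B r) (blockDeriv A₁ B₁ r) (blockDeriv₂ A₂ B₂ r) (.inr a) (.inl i)
      = 0 := by
  simp [diagRicci, diagChristoffel_block, diagChristoffelDeriv_block]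

theorem diagRicci_block_inr_inr (hA : A ≠ 0) (hB : B ≠ 0) (hr : r ≠ 0) (a c : Fin 2) :
    diagRicci (blockVal A B r) (blockDeriv A₁ B₁ r) (blockDeriv₂ A₂ B₂ r) (.inr a) (.inr c)
      = if a = c then 1 - 1 / B + r * B₁ 1 / (2 * B ^ 2) - r * A₁ 1 / (2 * A * B) else 0 := by
  simp only [diagRicci, Fintype.sum_sum_type, diagChristoffel_block, diagChristoffelDeriv_block]
  fin_cases a <;> fin_cases c <;>
  simp [diagChristoffel, diagFirstKind] <;> field_simp <;> ring

end Block

/-! ### The charts of `ℝ² × S²` -/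

/-- Euclidean plane, the model space of the sphere. -/
abbrev E2 : Type := EuclideanSpace ℝ (Fin 2)

/-- The inverse of the stereographic chart centred at `σ`, as a map into `ℝ³`. -/
def stereoInv (σ : S2) (w : E2) : E3 := ((stereographic' 2 (-σ)).symm w : S2)

/-- The conformal factor of the round metric in a stereographic chart. -/
def conformalFactor (w : E2) : ℝ := 16 / (‖w‖ ^ 2 + 4) ^ 2

lemma extChartAt_symm_apply (x : Ambient) (u : (ℝ × ℝ) × E2) :
    (extChartAt J x).symm u = (u.1, (stereographic' 2 (-x.2)).symm u.2) := rfl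

lemma extChartAt_target (x : Ambient) : (extChartAt J x).target = Set.univ := by
  rw [extChartAt_prod]
  ext u
  simp only [PartialEquiv.prod_target, Set.mem_prod, Set.mem_univ, iff_true]
  constructor
  · rw [extChartAt_model_space_eq_id]
    exact Set.mem_univ _
  · rw [extChartAt]
    simp only [mfld_simps]
    change _ ∈ (stereographic' 2 (-x.2)).target
    simp

lemma extChartAt_apply_self (x : Ambient) : extChartAt J x x = (x.1, 0) := by
  have h : stereographic' 2 (-x.2) x.2 = 0 := by
    rw [stereographic', OpenPartialHomeomorph.coe_trans, Function.comp_apply]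
    erw [stereographic_neg_apply x.2]
    exact map_zero (OrthonormalBasis.fromOrthogonalSpanSingleton (𝕜 := ℝ) 2
      (ne_zero_of_mem_unit_sphere (-x.2))).repr
  exact Prod.ext rfl h

lemma mdifferentiableAt_extChartAt_symm (x : Ambient) (u : (ℝ × ℝ) × E2) :
    MDifferentiableAt 𝓘(ℝ, (ℝ × ℝ) × E2) J (extChartAt J x).symm u := by
  have h := mdifferentiableWithinAt_extChartAt_symm (I := J) (x := x) (z := u)
    (by rw [extChartAt_target]; trivial)
  rwa [ModelWithCorners.Boundaryless.range_eq_univ, mdifferentiableWithinAt_univ] at h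

section Stereographic

variable (σ : S2)

/-- The linear isometry of `ℝ²` onto the tangent plane of the sphere at `σ` that underlies the
stereographic chart centred at `σ`. -/
def tangentIsometry : E2 →ₗᵢ[ℝ] E3 :=
  (Submodule.subtypeₗᵢ _).comp (OrthonormalBasis.fromOrthogonalSpanSingleton (𝕜 := ℝ) 2
    (ne_zero_of_mem_unit_sphere (-σ))).repr.symm.toLinearIsometry

lemma inner_tangentIsometry (w : E2) : inner ℝ (tangentIsometry σ w) (σ : E3) = 0 := by
  have h : tangentIsometry σ w ∈ (ℝ ∙ ((-σ : S2) : E3))ᗮ :=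
    ((OrthonormalBasis.fromOrthogonalSpanSingleton (𝕜 := ℝ) 2
      (ne_zero_of_mem_unit_sphere (-σ))).repr.symm w).2
  rw [Submodule.mem_orthogonal_singleton_iff_inner_left] at h
  simpa using h

lemma stereoInv_apply (w : E2) :
    stereoInv σ w = (‖w‖ ^ 2 + 4)⁻¹ • ((4 : ℝ) • tangentIsometry σ w - (‖w‖ ^ 2 - 4) • (σ : E3)) := by
  have h : ‖tangentIsometry σ w‖ = ‖w‖ := (tangentIsometry σ).norm_map w
  rw [stereoInv, stereographic'_symm_apply]
  simp only [sub_eq_add_neg, smul_add]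
  change (‖tangentIsometry σ w‖ ^ 2 + 4)⁻¹ • (4 : ℝ) • tangentIsometry σ w
    + (‖tangentIsometry σ w‖ ^ 2 + 4)⁻¹ • (‖tangentIsometry σ w‖ ^ 2 - 4) • (-(σ : E3)) = _
  rw [h]
  congr 1
  module

lemma hasFDerivAt_norm_sq_add (w : E2) :
    HasFDerivAt (fun w : E2 => ‖w‖ ^ 2 + 4) (2 • innerSL ℝ w) w :=
  (hasStrictFDerivAt_norm_sq w).hasFDerivAt.add_const 4

lemma norm_sq_add_four_ne_zero (w : E2) : ‖w‖ ^ 2 + 4 ≠ 0 := by positivity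

lemma contDiff_stereoInv : ContDiff ℝ ∞ (stereoInv σ) := by
  have h : stereoInv σ = fun w => (‖w‖ ^ 2 + 4)⁻¹ •
      ((4 : ℝ) • tangentIsometry σ w - (‖w‖ ^ 2 - 4) • (σ : E3)) := funext (stereoInv_apply σ)
  have h1 : ContDiff ℝ ∞ fun w : E2 => ‖w‖ ^ 2 := contDiff_norm_sq ℝ
  rw [h]
  exact ((h1.add contDiff_const).inv norm_sq_add_four_ne_zero).fun_smul
    ((contDiff_const.fun_smul (tangentIsometry σ).contDiff).sub
      ((h1.sub contDiff_const).fun_smul contDiff_const))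

lemma fderiv_stereoInv (w e : E2) :
    fderiv ℝ (stereoInv σ) w e = (‖w‖ ^ 2 + 4)⁻¹ • ((4 : ℝ) • tangentIsometry σ e
      - (2 * inner ℝ w e) • (σ : E3) - (2 * inner ℝ w e) • stereoInv σ w) := by
  have h : (fun w => (‖w‖ ^ 2 + 4) • stereoInv σ w)
      = fun w => (4 : ℝ) • tangentIsometry σ w - (‖w‖ ^ 2 + 4 - 8) • (σ : E3) := by
    funext w
    rw [stereoInv_apply, smul_inv_smul₀ (norm_sq_add_four_ne_zero w)]
    congr 2
    ring
  have hd := (contDiff_stereoInv σ).differentiable (by simp) w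
  have h1 := (hasFDerivAt_norm_sq_add w).smul hd.hasFDerivAt
  have h2 := ((tangentIsometry σ).toContinuousLinearMap.hasFDerivAt (x := w)).const_smul (4 : ℝ)
  have h3 := h2.sub (((hasFDerivAt_norm_sq_add w).sub_const 8).smul_const (σ : E3))
  have h4 := h1.unique
    (h3.congr_of_eventuallyEq (Filter.Eventually.of_forall fun y => congrFun h y))
  have h5 := congrArg (fun L => L e) h4
  simp at h5
  rw [eq_inv_smul_iff₀ (norm_sq_add_four_ne_zero w), eq_sub_iff_add_eq]
  exact h5

lemma inner_fderiv_stereoInv (w e e' : E2) :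
    inner ℝ (fderiv ℝ (stereoInv σ) w e) (fderiv ℝ (stereoInv σ) w e')
      = conformalFactor w * inner ℝ e e' := by
  have hσ : inner ℝ (σ : E3) (σ : E3) = (1 : ℝ) := by simp
  have hi := inner_tangentIsometry σ
  have hi' : ∀ w, inner ℝ (σ : E3) (tangentIsometry σ w) = 0 := fun w => by
    rw [real_inner_comm, hi]
  have hii : ∀ a b, inner ℝ (tangentIsometry σ a) (tangentIsometry σ b) = inner ℝ a b :=
    (tangentIsometry σ).inner_map_map
  have hw := norm_sq_add_four_ne_zero w
  have hn : inner ℝ w w = ‖w‖ ^ 2 := real_inner_self_eq_norm_sq w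
  have hc : inner ℝ e w = inner ℝ w e := real_inner_comm _ _
  simp only [fderiv_stereoInv, stereoInv_apply, inner_smul_left, inner_smul_right, inner_sub_left,
    inner_sub_right, hσ, hi, hi', hii, hn, hc, conformalFactor, conj_trivial]
  field_simp
  ring

end Stereographic

lemma mdifferentiableAt_coe_snd (x : Ambient) :
    MDifferentiableAt J 𝓘(ℝ, E3) (fun y : Ambient => (y.2 : E3)) x := by
  have := (contMDiff_coe_sphere (E := E3) (n := 2) (m := 1)).mdifferentiableAt (x := x.2) one_ne_zero
  exact this.comp x mdifferentiableAt_snd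

lemma dSphere_mfderiv_symm (x : Ambient) (u e : (ℝ × ℝ) × E2) :
    dSphere ((extChartAt J x).symm u) (mfderiv 𝓘(ℝ, (ℝ × ℝ) × E2) J (extChartAt J x).symm u e)
      = fderiv ℝ (stereoInv x.2) u.2 e.2 := by
  have h := mfderiv_comp u (mdifferentiableAt_coe_snd ((extChartAt J x).symm u))
    (mdifferentiableAt_extChartAt_symm x u)
  have h1 : (fun y : Ambient => (y.2 : E3)) ∘ (extChartAt J x).symm
      = fun u => stereoInv x.2 u.2 := rfl
  have h2 : HasFDerivAt (fun u : (ℝ × ℝ) × E2 => stereoInv x.2 u.2)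
      ((fderiv ℝ (stereoInv x.2) u.2).comp (ContinuousLinearMap.snd ℝ (ℝ × ℝ) E2)) u :=
    ((contDiff_stereoInv x.2).differentiable (by simp) u.2).hasFDerivAt.comp u hasFDerivAt_snd
  rw [h1, mfderiv_eq_fderiv, h2.fderiv] at h
  exact (DFunLike.congr_fun h e).symm

lemma dBase_mfderiv_symm (x : Ambient) {f : ℝ × ℝ → ℝ} (u e : (ℝ × ℝ) × E2)
    (hf : DifferentiableAt ℝ f u.1) :
    dBase f ((extChartAt J x).symm u) (mfderiv 𝓘(ℝ, (ℝ × ℝ) × E2) J (extChartAt J x).symm u e)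
      = fderiv ℝ f u.1 e.1 := by
  have h0 : MDifferentiableAt J 𝓘(ℝ, ℝ) (fun y : Ambient => f y.1) ((extChartAt J x).symm u) :=
    MDifferentiableAt.comp (g := f) (f := Prod.fst) ((extChartAt J x).symm u)
      hf.mdifferentiableAt mdifferentiableAt_fst
  have h := mfderiv_comp u h0 (mdifferentiableAt_extChartAt_symm x u)
  have h1 : (fun y : Ambient => f y.1) ∘ (extChartAt J x).symm = fun u => f u.1 := rfl
  have h2 : HasFDerivAt (fun u : (ℝ × ℝ) × E2 => f u.1)
      ((fderiv ℝ f u.1).comp (ContinuousLinearMap.fst ℝ (ℝ × ℝ) E2)) u :=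
    hf.hasFDerivAt.comp u hasFDerivAt_fst
  rw [h1, mfderiv_eq_fderiv, h2.fderiv] at h
  exact (DFunLike.congr_fun h e).symm

lemma mfderiv_fst_apply (x : Ambient) (v : TangentSpace J x) :
    mfderiv J 𝓘(ℝ, ℝ × ℝ) (fun y : Ambient => y.1) x v = v.1 := by
  have := mfderiv_fst (I := 𝓘(ℝ, ℝ × ℝ)) (I' := 𝓡 2) (x := x)
  exact DFunLike.congr_fun this v

lemma dBase_apply (x : Ambient) {f : ℝ × ℝ → ℝ} (v : TangentSpace J x)
    (hf : DifferentiableAt ℝ f x.1) : dBase f x v = fderiv ℝ f x.1 v.1 := by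
  have h := mfderiv_comp (g := f) (f := Prod.fst) (I := J) (I' := 𝓘(ℝ, ℝ × ℝ)) (I'' := 𝓘(ℝ, ℝ)) x
      hf.mdifferentiableAt mdifferentiableAt_fst
  have h1 := DFunLike.congr_fun h v
  rw [mfderiv_eq_fderiv] at h1
  refine h1.trans ?_
  exact congrArg (fderiv ℝ f x.1) (mfderiv_fst_apply x v)

lemma dSphere_apply (x : Ambient) (v : TangentSpace J x) :
    dSphere x v = tangentIsometry x.2 v.2 := by
  have hs : x ∈ (chartAt (ModelProd (ℝ × ℝ) E2) x).source := mem_chart_source _ x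
  have h1 : (fun y : Ambient => (y.2 : E3)) =ᶠ[nhds x]
      (fun u : (ℝ × ℝ) × E2 => stereoInv x.2 u.2) ∘ extChartAt J x := by
    filter_upwards [extChartAt_source_mem_nhds (I := J) x] with y hy
    have h := (extChartAt J x).left_inv hy
    rw [extChartAt_symm_apply] at h
    exact (congrArg (fun y : Ambient => (y.2 : E3)) h).symm
  have h2 : HasFDerivAt (fun u : (ℝ × ℝ) × E2 => stereoInv x.2 u.2)
      ((fderiv ℝ (stereoInv x.2) (extChartAt J x x).2).comp
        (ContinuousLinearMap.snd ℝ (ℝ × ℝ) E2)) (extChartAt J x x) :=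
    ((contDiff_stereoInv x.2).differentiable (by simp) _).hasFDerivAt.comp _ hasFDerivAt_snd
  have h3 := mfderiv_comp x h2.differentiableAt.mdifferentiableAt
    (mdifferentiableAt_extChartAt (I := J) hs)
  rw [mfderiv_extChartAt_self, mfderiv_eq_fderiv, h2.fderiv, extChartAt_apply_self] at h3
  have h4 : dSphere x v = fderiv ℝ (stereoInv x.2) 0 v.2 := by
    rw [dSphere, h1.mfderiv_eq]
    exact DFunLike.congr_fun h3 v
  rw [h4, fderiv_stereoInv]
  simp

lemma dSigmaSq_apply (x : Ambient) (v w : TangentSpace J x) :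
    dSigmaSq x v w = inner ℝ v.2 w.2 := by
  rw [dSigmaSq, dSphere_apply, dSphere_apply, LinearIsometry.inner_map_map]

lemma mem_tangentS {x : Ambient} {v : TangentSpace J x} : v ∈ tangentS x ↔ v.1 = 0 := by
  rw [tangentS, Set.mem_ofPred_eq, mfderiv_fst_apply]
  rfl

/-! ### Metrics of the form `-A dt² + B dr² + r² dσ²` -/

/-- On `X`, `g = -A(t, r) dt² + B(t, r) dr² + r² dσ²`. -/
def HasBlockForm (t₀ t₁ r₀ r₁ : EReal) (g : MetricField) (A B : ℝ × ℝ → ℝ) : Prop :=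
  ∀ x ∈ spaceTime t₀ t₁ r₀ r₁, ∀ v w : TangentSpace J x,
    g x v w = -A x.1 * (v.1.1 * w.1.1) + B x.1 * (v.1.2 * w.1.2)
      + radius x ^ 2 * dSigmaSq x v w

/-- The coordinate directions of the plane of `(t, r)`. -/
def dir : Fin 2 → ℝ × ℝ := ![(1, 0), (0, 1)]

lemma stdBasis_inl (i : Fin 2) : stdBasis (.inl i) = (dir i, 0) := by
  fin_cases i <;> simp [stdBasis, dir]

lemma stdBasis_inr (a : Fin 2) : stdBasis (.inr a) = (0, EuclideanSpace.single a 1) := by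
  simp [stdBasis]

lemma stdBasis_repr_inl (v : (ℝ × ℝ) × E2) (i : Fin 2) :
    stdBasis.repr v (.inl i) = ![v.1.1, v.1.2] i := by
  simp [stdBasis]

lemma stdBasis_repr_inr (v : (ℝ × ℝ) × E2) (a : Fin 2) : stdBasis.repr v (.inr a) = v.2 a := by
  simp [stdBasis]

lemma isOpen_openInterval (a b : EReal) : IsOpen (openInterval a b) :=
  (isOpen_lt continuous_const continuous_coe_real_ereal).inter
    (isOpen_lt continuous_coe_real_ereal continuous_const)

lemma isOpen_rectangle (t₀ t₁ r₀ r₁ : EReal) : IsOpen (rectangle t₀ t₁ r₀ r₁) :=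
  (isOpen_openInterval _ _).prod (isOpen_openInterval _ _)

lemma pos_of_mem_openInterval {r₀ r₁ : EReal} (hr₀ : 0 ≤ r₀) {r : ℝ} (hr : r ∈ openInterval r₀ r₁) :
    0 < r := by
  exact_mod_cast hr₀.trans_lt hr.1

/-- The factors depending on `(t, r)` of the entries of the metric in a stereographic chart. -/
def baseFactor (A B : ℝ × ℝ → ℝ) : Fin 2 ⊕ Fin 2 → ℝ × ℝ → ℝ :=
  Sum.elim ![fun p => -A p, B] fun _ p => p.2 ^ 2

/-- The factors depending on the point of the sphere of the entries of the metric in a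
stereographic chart. -/
def sphereFactor : Fin 2 ⊕ Fin 2 → E2 → ℝ :=
  Sum.elim (fun _ _ => 1) fun _ => conformalFactor

lemma chartMatrix_block {t₀ t₁ r₀ r₁ : EReal} {g : MetricField} {A B : ℝ × ℝ → ℝ}
    (hg : HasBlockForm t₀ t₁ r₀ r₁ g A B) (x : Ambient) {u : (ℝ × ℝ) × E2}
    (hu : u.1 ∈ rectangle t₀ t₁ r₀ r₁) :
    chartMatrix stdBasis g x u
      = Matrix.diagonal fun i => baseFactor A B i u.1 * sphereFactor i u.2 := by
  have key : ∀ e e' : (ℝ × ℝ) × E2, g ((extChartAt J x).symm u)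
      (mfderiv 𝓘(ℝ, (ℝ × ℝ) × E2) J (extChartAt J x).symm u e)
      (mfderiv 𝓘(ℝ, (ℝ × ℝ) × E2) J (extChartAt J x).symm u e')
      = -A u.1 * (e.1.1 * e'.1.1) + B u.1 * (e.1.2 * e'.1.2)
        + u.1.2 ^ 2 * (conformalFactor u.2 * inner ℝ e.2 e'.2) := by
    intro e e'
    have h1 : ∀ e : (ℝ × ℝ) × E2,
        (mfderiv 𝓘(ℝ, (ℝ × ℝ) × E2) J (extChartAt J x).symm u e).1.1 = e.1.1 := by
      intro e
      have h := dBase_mfderiv_symm x (f := Prod.fst) u e differentiableAt_fst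
      rw [dBase_apply _ _ differentiableAt_fst, fderiv_fst, fderiv_fst] at h
      exact h
    have h2 : ∀ e : (ℝ × ℝ) × E2,
        (mfderiv 𝓘(ℝ, (ℝ × ℝ) × E2) J (extChartAt J x).symm u e).1.2 = e.1.2 := by
      intro e
      have h := dBase_mfderiv_symm x (f := Prod.snd) u e differentiableAt_snd
      rw [dBase_apply _ _ differentiableAt_snd, fderiv_snd, fderiv_snd] at h
      exact h
    rw [hg ((extChartAt J x).symm u) hu, dSigmaSq, dSphere_mfderiv_symm, dSphere_mfderiv_symm,
      inner_fderiv_stereoInv]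
    erw [h1 e, h1 e', h2 e, h2 e']
    rfl
  ext i j
  rw [chartMatrix, Matrix.of_apply, key]
  rcases i with i | i <;> rcases j with j | j
  · fin_cases i <;> fin_cases j <;> simp [stdBasis_inl, dir, baseFactor, sphereFactor]
  · simp [stdBasis_inl, stdBasis_inr]
  · simp [stdBasis_inl, stdBasis_inr]
  · by_cases h : i = j
    · subst h
      simp [stdBasis_inr, baseFactor, sphereFactor]
    · simp [stdBasis_inr, h, EuclideanSpace.inner_single_left]

lemma hasFDerivAt_mul_prod {P : ℝ × ℝ → ℝ} {Q : E2 → ℝ} {u : (ℝ × ℝ) × E2}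
    (hP : DifferentiableAt ℝ P u.1) (hQ : DifferentiableAt ℝ Q u.2) :
    HasFDerivAt (fun u : (ℝ × ℝ) × E2 => P u.1 * Q u.2)
      (P u.1 • (fderiv ℝ Q u.2).comp (ContinuousLinearMap.snd ℝ (ℝ × ℝ) E2)
        + Q u.2 • (fderiv ℝ P u.1).comp (ContinuousLinearMap.fst ℝ (ℝ × ℝ) E2)) u :=
  (hP.hasFDerivAt.comp u hasFDerivAt_fst).mul (hQ.hasFDerivAt.comp u hasFDerivAt_snd)

lemma partialDeriv_inl_mul {P : ℝ × ℝ → ℝ} {Q : E2 → ℝ} {u : (ℝ × ℝ) × E2}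
    (hP : DifferentiableAt ℝ P u.1) (hQ : DifferentiableAt ℝ Q u.2) (i : Fin 2) :
    partialDeriv stdBasis (.inl i) (fun u : (ℝ × ℝ) × E2 => P u.1 * Q u.2) u
      = fderiv ℝ P u.1 (dir i) * Q u.2 := by
  rw [partialDeriv, (hasFDerivAt_mul_prod hP hQ).fderiv, stdBasis_inl]
  simp [mul_comm]

lemma partialDeriv_inr_mul {P : ℝ × ℝ → ℝ} {Q : E2 → ℝ} {u : (ℝ × ℝ) × E2}
    (hP : DifferentiableAt ℝ P u.1) (hQ : DifferentiableAt ℝ Q u.2) (a : Fin 2) :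
    partialDeriv stdBasis (.inr a) (fun u : (ℝ × ℝ) × E2 => P u.1 * Q u.2) u
      = P u.1 * fderiv ℝ Q u.2 (EuclideanSpace.single a 1) := by
  rw [partialDeriv, (hasFDerivAt_mul_prod hP hQ).fderiv, stdBasis_inr]
  simp

/-! ### Derivatives of the conformal factor -/

lemma contDiff_conformalFactor : ContDiff ℝ ∞ conformalFactor := by
  have h1 : ContDiff ℝ ∞ fun w : E2 => ‖w‖ ^ 2 := contDiff_norm_sq ℝ
  exact contDiff_const.div ((h1.add contDiff_const).pow 2) fun w =>
    pow_ne_zero _ (norm_sq_add_four_ne_zero w)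

lemma conformalFactor_zero : conformalFactor 0 = 1 := by
  norm_num [conformalFactor]

lemma conformalFactor_ne_zero (w : E2) : conformalFactor w ≠ 0 := by
  have := norm_sq_add_four_ne_zero w
  simp [conformalFactor, this]

lemma fderiv_conformalFactor (w e : E2) :
    fderiv ℝ conformalFactor w e = -64 * ((‖w‖ ^ 2 + 4) ^ 3)⁻¹ * inner ℝ w e := by
  have hw := norm_sq_add_four_ne_zero w
  have h1 := (hasDerivAt_inv (pow_ne_zero 2 hw)).comp_hasFDerivAt w ((hasFDerivAt_norm_sq_add w).pow 2)
  have h2 : HasFDerivAt conformalFactor _ w := h1.const_mul 16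
  rw [h2.fderiv]
  simp
  field_simp
  ring

lemma fderiv_fderiv_conformalFactor (e e' : E2) :
    fderiv ℝ (fun w => fderiv ℝ conformalFactor w e) 0 e' = -inner ℝ e e' := by
  simp only [fderiv_conformalFactor]
  have h1 : HasFDerivAt (fun w : E2 => inner ℝ w e) (innerSL ℝ e) 0 := by
    have := (innerSL ℝ e).hasFDerivAt (x := (0 : E2))
    refine this.congr_of_eventuallyEq (Filter.Eventually.of_forall fun w => ?_)
    simp [real_inner_comm]
  have h0 := norm_sq_add_four_ne_zero (0 : E2)
  have h2 := ((hasDerivAt_inv (pow_ne_zero 3 h0)).comp_hasFDerivAt 0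
    ((hasFDerivAt_norm_sq_add 0).pow 3)).const_mul (-64)
  have h3 : HasFDerivAt (fun w : E2 => -64 * ((‖w‖ ^ 2 + 4) ^ 3)⁻¹ * inner ℝ w e) _ 0 := h2.mul h1
  rw [h3.fderiv]
  simp
  norm_num

/-! ### The stress-energy tensor of a metric of the form `-A dt² + B dr² + r² dσ²` -/

/-- The first partial derivatives of a function of `(t, r)`. -/
def grad (f : ℝ × ℝ → ℝ) (p : ℝ × ℝ) (i : Fin 2) : ℝ := fderiv ℝ f p (dir i)

/-- The second partial derivatives of a function of `(t, r)`. -/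
def hess (f : ℝ × ℝ → ℝ) (p : ℝ × ℝ) (i j : Fin 2) : ℝ := grad (fun q => grad f q i) p j

lemma contDiffOn_grad {f : ℝ × ℝ → ℝ} {U : Set (ℝ × ℝ)} (hU : IsOpen U) (hf : ContDiffOn ℝ ∞ f U)
    (i : Fin 2) : ContDiffOn ℝ ∞ (fun p => grad f p i) U :=
  (hf.fderiv_of_isOpen hU (by simp)).clm_apply contDiffOn_const

lemma hess_symm {f : ℝ × ℝ → ℝ} {U : Set (ℝ × ℝ)} (hU : IsOpen U) (hf : ContDiffOn ℝ ∞ f U)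
    {p : ℝ × ℝ} (hp : p ∈ U) (i j : Fin 2) : hess f p i j = hess f p j i := by
  have hfp := hf.contDiffAt (hU.mem_nhds hp)
  have hd : DifferentiableAt ℝ (fderiv ℝ f) p :=
    ((hf.fderiv_of_isOpen hU (m := ∞) (by simp)).contDiffAt (hU.mem_nhds hp)).differentiableAt
      (by simp)
  have h : ∀ i j, hess f p i j = fderiv ℝ (fderiv ℝ f) p (dir j) (dir i) := by
    intro i j
    have h1 : HasFDerivAt (fun q => grad f q i) _ p := hd.hasFDerivAt.clm_apply (hasFDerivAt_const _ _)
    rw [hess, grad, h1.fderiv]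
    simp
  rw [h, h]
  exact (hfp.isSymmSndFDerivAt (by simp; exact WithTop.coe_le_coe.2 le_top)) _ _

lemma grad_neg (f : ℝ × ℝ → ℝ) (p : ℝ × ℝ) (i : Fin 2) :
    grad (fun q => -f q) p i = -grad f p i := by
  simp [grad]

lemma hess_neg (f : ℝ × ℝ → ℝ) (p : ℝ × ℝ) (i j : Fin 2) :
    hess (fun q => -f q) p i j = -hess f p i j := by
  simp only [hess, grad_neg]

lemma grad_snd_sq (p : ℝ × ℝ) (i : Fin 2) :
    grad (fun q => q.2 ^ 2) p i = ![0, 2 * p.2] i := by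
  have h : HasFDerivAt (fun q : ℝ × ℝ => q.2 ^ 2) _ p :=
    (hasFDerivAt_snd (𝕜 := ℝ) (p := p)).pow 2
  rw [grad, h.fderiv]
  fin_cases i <;> simp [dir]

lemma hess_snd_sq (p : ℝ × ℝ) (i j : Fin 2) :
    hess (fun q => q.2 ^ 2) p i j = ![![0, 0], ![0, 2]] i j := by
  simp only [hess, grad_snd_sq]
  have h : HasFDerivAt (fun q : ℝ × ℝ => 2 * q.2) _ p :=
    (hasFDerivAt_snd (𝕜 := ℝ) (p := p)).const_mul 2
  fin_cases i
  · fin_cases j <;> simp [grad]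
  · simp only [grad]
    simp [h.fderiv]
    fin_cases j <;> simp [dir]

section Block

variable {t₀ t₁ r₀ r₁ : EReal} {A B : ℝ × ℝ → ℝ}

lemma contDiffOn_baseFactor (hA : ContDiffOn ℝ ∞ A (rectangle t₀ t₁ r₀ r₁))
    (hB : ContDiffOn ℝ ∞ B (rectangle t₀ t₁ r₀ r₁)) (i : Fin 2 ⊕ Fin 2) :
    ContDiffOn ℝ ∞ (baseFactor A B i) (rectangle t₀ t₁ r₀ r₁) := by
  rcases i with i | i
  · fin_cases i
    · exact hA.neg
    · exact hB
  · exact (contDiff_snd.pow 2).contDiffOn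

lemma contDiff_sphereFactor (i : Fin 2 ⊕ Fin 2) : ContDiff ℝ ∞ (sphereFactor i) := by
  rcases i with i | i
  · exact contDiff_const
  · exact contDiff_conformalFactor

lemma contDiffOn_entry (hA : ContDiffOn ℝ ∞ A (rectangle t₀ t₁ r₀ r₁))
    (hB : ContDiffOn ℝ ∞ B (rectangle t₀ t₁ r₀ r₁)) (i : Fin 2 ⊕ Fin 2) :
    ContDiffOn ℝ ∞ (fun u : (ℝ × ℝ) × E2 => baseFactor A B i u.1 * sphereFactor i u.2)
      (Prod.fst ⁻¹' rectangle t₀ t₁ r₀ r₁) :=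
  ((contDiffOn_baseFactor hA hB i).comp contDiff_fst.contDiffOn fun _ hu => hu).mul
    ((contDiff_sphereFactor i).comp contDiff_snd).contDiffOn

lemma entry_center (p : ℝ × ℝ) :
    (fun i => baseFactor A B i p * sphereFactor i 0) = blockVal (A p) (B p) p.2 := by
  ext i
  rcases i with i | i
  · fin_cases i <;> simp [baseFactor, sphereFactor, blockVal]
  · simp [baseFactor, sphereFactor, blockVal, conformalFactor_zero]

lemma partialDeriv_entry_center (hA : ContDiffOn ℝ ∞ A (rectangle t₀ t₁ r₀ r₁))
    (hB : ContDiffOn ℝ ∞ B (rectangle t₀ t₁ r₀ r₁)) {p : ℝ × ℝ}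
    (hp : p ∈ rectangle t₀ t₁ r₀ r₁) :
    (fun i j => partialDeriv stdBasis j
        (fun u : (ℝ × ℝ) × E2 => baseFactor A B i u.1 * sphereFactor i u.2) (p, 0))
      = blockDeriv (grad A p) (grad B p) p.2 := by
  have hP : ∀ i, DifferentiableAt ℝ (baseFactor A B i) p := fun i =>
    ((contDiffOn_baseFactor hA hB i).contDiffAt
      ((isOpen_rectangle _ _ _ _).mem_nhds hp)).differentiableAt (by simp)
  have hQ : ∀ i, DifferentiableAt ℝ (sphereFactor i) 0 := fun i =>
    (contDiff_sphereFactor i).differentiable (by simp) 0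
  ext i j
  rcases j with j | j
  · rw [partialDeriv_inl_mul (u := (p, 0)) (hP i) (hQ i)]
    change grad (baseFactor A B i) p j * _ = _
    rcases i with i | i
    · fin_cases i <;> simp [baseFactor, sphereFactor, blockDeriv, grad_neg]
    · simp [baseFactor, sphereFactor, blockDeriv, grad_snd_sq, conformalFactor_zero]
  · rw [partialDeriv_inr_mul (u := (p, 0)) (hP i) (hQ i)]
    rcases i with i | i
    · simp [sphereFactor, blockDeriv]
    · simp [sphereFactor, blockDeriv, fderiv_conformalFactor]

lemma partialDeriv_partialDeriv_entry_center (hA : ContDiffOn ℝ ∞ A (rectangle t₀ t₁ r₀ r₁))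
    (hB : ContDiffOn ℝ ∞ B (rectangle t₀ t₁ r₀ r₁)) {p : ℝ × ℝ}
    (hp : p ∈ rectangle t₀ t₁ r₀ r₁) :
    (fun i j k => partialDeriv stdBasis k (partialDeriv stdBasis j
        (fun u : (ℝ × ℝ) × E2 => baseFactor A B i u.1 * sphereFactor i u.2)) (p, 0))
      = blockDeriv₂ (hess A p) (hess B p) p.2 := by
  have hopen := isOpen_rectangle t₀ t₁ r₀ r₁
  have hP : ∀ i, ∀ q ∈ rectangle t₀ t₁ r₀ r₁, DifferentiableAt ℝ (baseFactor A B i) q :=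
    fun i q hq => ((contDiffOn_baseFactor hA hB i).contDiffAt
      (hopen.mem_nhds hq)).differentiableAt (by simp)
  have hP' : ∀ i j, DifferentiableAt ℝ (fun q => grad (baseFactor A B i) q j) p :=
    fun i j => ((contDiffOn_grad hopen (contDiffOn_baseFactor hA hB i) j).contDiffAt
      (hopen.mem_nhds hp)).differentiableAt (by simp)
  have hQ : ∀ i w, DifferentiableAt ℝ (sphereFactor i) w := fun i =>
    (contDiff_sphereFactor i).differentiable (by simp)
  have hQ' : ∀ i (e : E2), DifferentiableAt ℝ (fun w => fderiv ℝ (sphereFactor i) w e) 0 :=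
    fun i e => (((contDiff_sphereFactor i).fderiv_right (m := ∞) (by simp)).clm_apply
      contDiff_const).differentiable (by simp) 0
  have hnear : ∀ᶠ u : (ℝ × ℝ) × E2 in nhds (p, 0), u.1 ∈ rectangle t₀ t₁ r₀ r₁ :=
    (hopen.preimage continuous_fst).mem_nhds hp
  ext i j k
  rcases j with j | j
  · have h1 : partialDeriv stdBasis (.inl j)
        (fun u : (ℝ × ℝ) × E2 => baseFactor A B i u.1 * sphereFactor i u.2) =ᶠ[nhds (p, 0)]
        fun u => grad (baseFactor A B i) u.1 j * sphereFactor i u.2 := by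
      filter_upwards [hnear] with u hu
      exact partialDeriv_inl_mul (hP i _ hu) (hQ i _) j
    rw [partialDeriv_congr h1]
    rcases k with k | k
    · rw [partialDeriv_inl_mul (P := fun q => grad (baseFactor A B i) q j) (u := (p, 0)) (hP' i j) (hQ i 0)]
      change hess (baseFactor A B i) p j k * _ = _
      rcases i with i | i
      · fin_cases i <;> simp [baseFactor, sphereFactor, blockDeriv₂, hess_neg]
      · simp [baseFactor, sphereFactor, blockDeriv₂, hess_snd_sq, conformalFactor_zero]
    · rw [partialDeriv_inr_mul (P := fun q => grad (baseFactor A B i) q j) (u := (p, 0)) (hP' i j) (hQ i 0)]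
      rcases i with i | i
      · simp [sphereFactor, blockDeriv₂]
      · simp [sphereFactor, blockDeriv₂, fderiv_conformalFactor]
  · have h1 : partialDeriv stdBasis (.inr j)
        (fun u : (ℝ × ℝ) × E2 => baseFactor A B i u.1 * sphereFactor i u.2) =ᶠ[nhds (p, 0)]
        fun u => baseFactor A B i u.1
          * (fun w => fderiv ℝ (sphereFactor i) w (EuclideanSpace.single j 1)) u.2 := by
      filter_upwards [hnear] with u hu
      exact partialDeriv_inr_mul (hP i _ hu) (hQ i _) j
    rw [partialDeriv_congr h1]
    rcases k with k | k
    · rw [partialDeriv_inl_mul (u := (p, 0)) (hP i p hp) (hQ' i _)]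
      rcases i with i | i
      · simp [sphereFactor, blockDeriv₂]
      · simp [sphereFactor, blockDeriv₂, fderiv_conformalFactor]
    · rw [partialDeriv_inr_mul (u := (p, 0)) (hP i p hp) (hQ' i _)]
      rcases i with i | i
      · simp [sphereFactor, blockDeriv₂]
      · simp only [sphereFactor, blockDeriv₂, Sum.elim_inr, fderiv_fderiv_conformalFactor]
        by_cases h : j = k <;> simp [baseFactor, h, EuclideanSpace.inner_single_left]

/-- On `X`, `g = -A(t, r) dt² + B(t, r) dr² + r² dσ²` with smooth positive functions `A` and
`B`. -/
structure IsBlockMetric (t₀ t₁ r₀ r₁ : EReal) (g : MetricField) (A B : ℝ × ℝ → ℝ) : Prop where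
  form : HasBlockForm t₀ t₁ r₀ r₁ g A B
  smooth_A : ContDiffOn ℝ ∞ A (rectangle t₀ t₁ r₀ r₁)
  smooth_B : ContDiffOn ℝ ∞ B (rectangle t₀ t₁ r₀ r₁)
  pos_A : ∀ p ∈ rectangle t₀ t₁ r₀ r₁, 0 < A p
  pos_B : ∀ p ∈ rectangle t₀ t₁ r₀ r₁, 0 < B p

variable {g : MetricField}

lemma ricciComp_block (hg : IsBlockMetric t₀ t₁ r₀ r₁ g A B) (hr₀ : 0 ≤ r₀)
    {x : Ambient} (hx : x ∈ spaceTime t₀ t₁ r₀ r₁) (j k : Fin 2 ⊕ Fin 2) :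
    ricciComp stdBasis (chartMatrix stdBasis g x) j k (extChartAt J x x)
      = diagRicci (blockVal (A x.1) (B x.1) x.1.2) (blockDeriv (grad A x.1) (grad B x.1) x.1.2)
          (blockDeriv₂ (hess A x.1) (hess B x.1) x.1.2) j k := by
  have h := ricciComp_of_diagonal stdBasis (G := chartMatrix stdBasis g x)
    (d := fun i u => baseFactor A B i u.1 * sphereFactor i u.2)
    (U := Prod.fst ⁻¹' rectangle t₀ t₁ r₀ r₁) ((isOpen_rectangle _ _ _ _).preimage continuous_fst)
    (fun u hu => chartMatrix_block hg.form x hu) ?_ (fun i => contDiffOn_entry hg.smooth_A hg.smooth_B i)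
    (u := (x.1, 0)) hx j k
  · rw [extChartAt_apply_self, h, partialDeriv_entry_center hg.smooth_A hg.smooth_B hx,
      partialDeriv_partialDeriv_entry_center hg.smooth_A hg.smooth_B hx]
    simp only [entry_center]
  · intro i u hu
    rcases i with i | i
    · fin_cases i
      · simpa [baseFactor, sphereFactor] using (hg.pos_A _ hu).ne'
      · simpa [baseFactor, sphereFactor] using (hg.pos_B _ hu).ne'
    · have := (pos_of_mem_openInterval hr₀ hu.2).ne'
      simpa [baseFactor, sphereFactor, conformalFactor_ne_zero] using this

theorem stressEnergy_block (hg : IsBlockMetric t₀ t₁ r₀ r₁ g A B) (hr₀ : 0 ≤ r₀)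
    {x : Ambient} (hx : x ∈ spaceTime t₀ t₁ r₀ r₁) (v w : TangentSpace J x) :
    stressEnergy stdBasis g x v w = (8 * Real.pi)⁻¹ *
      (A x.1 * ((1 - 1 / B x.1) / x.1.2 ^ 2 + grad B x.1 1 / (x.1.2 * B x.1 ^ 2))
          * (v.1.1 * w.1.1)
        + grad B x.1 0 / (x.1.2 * B x.1) * (v.1.1 * w.1.2 + v.1.2 * w.1.1)
        + (grad A x.1 1 / (x.1.2 * A x.1) - (B x.1 - 1) / x.1.2 ^ 2) * (v.1.2 * w.1.2)
        + x.1.2 ^ 2 / 2 * ((hess A x.1 1 1 - hess B x.1 0 0) / (A x.1 * B x.1)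
            + grad B x.1 0 ^ 2 / (2 * A x.1 * B x.1 ^ 2)
            + grad A x.1 0 * grad B x.1 0 / (2 * A x.1 ^ 2 * B x.1)
            - grad A x.1 1 * grad B x.1 1 / (2 * A x.1 * B x.1 ^ 2)
            - grad A x.1 1 ^ 2 / (2 * A x.1 ^ 2 * B x.1)
            + grad A x.1 1 / (x.1.2 * A x.1 * B x.1)
            - grad B x.1 1 / (x.1.2 * B x.1 ^ 2)) * inner ℝ v.2 w.2) := by
  have hopen := isOpen_rectangle t₀ t₁ r₀ r₁
  have hAx := (hg.pos_A _ hx).ne'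
  have hBx := (hg.pos_B _ hx).ne'
  have hrx : x.1.2 ≠ 0 := (pos_of_mem_openInterval hr₀ hx.2).ne'
  have hric := ricciComp_block hg hr₀ hx
  have htt := diagRicci_block_tt (A₁ := grad A x.1) (B₁ := grad B x.1) (A₂ := hess A x.1)
    (B₂ := hess B x.1) hAx hBx hrx
  have hrr := diagRicci_block_rr (A₁ := grad A x.1) (B₁ := grad B x.1) (A₂ := hess A x.1)
    (B₂ := hess B x.1) hAx hBx hrx
  have htr := diagRicci_block_tr (A₁ := grad A x.1) (B₁ := grad B x.1) (A₂ := hess A x.1)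
    (B₂ := hess B x.1) hAx hBx hrx (hess_symm hopen hg.smooth_A hx 0 1)
  have hrt := diagRicci_block_rt (A₁ := grad A x.1) (B₁ := grad B x.1) (A₂ := hess A x.1)
    (B₂ := hess B x.1) hAx hBx hrx (hess_symm hopen hg.smooth_B hx 0 1)
  have hθθ := diagRicci_block_inr_inr (A₁ := grad A x.1) (B₁ := grad B x.1) (A₂ := hess A x.1)
    (B₂ := hess B x.1) hAx hBx hrx
  have hinv : (chartMatrix stdBasis g x (extChartAt J x x))⁻¹
      = Matrix.diagonal fun i => (blockVal (A x.1) (B x.1) x.1.2 i)⁻¹ := by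
    rw [extChartAt_apply_self, chartMatrix_block hg.form x (u := (x.1, 0)) hx]
    apply Matrix.inv_eq_right_inv
    simp only [entry_center]
    rw [Matrix.diagonal_mul_diagonal, ← Matrix.diagonal_one]
    congr 1
    ext i
    apply mul_inv_cancel₀
    rcases i with i | i
    · fin_cases i <;> simp [blockVal, hAx, hBx]
    · simp [blockVal, hrx]
  have hv : ∀ v : TangentSpace J x, mfderiv J 𝓘(ℝ, (ℝ × ℝ) × E2) (extChartAt J x) x v = v := by
    intro v
    rw [mfderiv_extChartAt_self]
    rfl
  have hmix : ∀ i a, diagRicci (blockVal (A x.1) (B x.1) x.1.2) (blockDeriv (grad A x.1) (grad B x.1) x.1.2)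
          (blockDeriv₂ (hess A x.1) (hess B x.1) x.1.2) (.inl i) (.inr a) = 0 := diagRicci_block_inl_inr
  have hmix' : ∀ i a, diagRicci (blockVal (A x.1) (B x.1) x.1.2) (blockDeriv (grad A x.1) (grad B x.1) x.1.2)
          (blockDeriv₂ (hess A x.1) (hess B x.1) x.1.2) (.inr a) (.inl i) = 0 := diagRicci_block_inr_inl
  generalize diagRicci (blockVal (A x.1) (B x.1) x.1.2) (blockDeriv (grad A x.1) (grad B x.1) x.1.2)
          (blockDeriv₂ (hess A x.1) (hess B x.1) x.1.2) = R
    at hric htt hrr htr hrt hθθ hmix hmix'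
  have hs : scalarCurvature stdBasis g x
      = -R (.inl 0) (.inl 0) / A x.1
        + R (.inl 1) (.inl 1) / B x.1
        + 2 * (1 - 1 / B x.1 + x.1.2 * grad B x.1 1 / (2 * B x.1 ^ 2)
          - x.1.2 * grad A x.1 1 / (2 * A x.1 * B x.1)) / x.1.2 ^ 2 := by
    rw [scalarCurvature, scalarComp, hinv]
    simp only [hric]
    simp [Matrix.diagonal_apply, blockVal, hθθ]
    ring
  have hr : ricci stdBasis g x v w
      = R (.inl 0) (.inl 0) * (v.1.1 * w.1.1)
        + grad B x.1 0 / (x.1.2 * B x.1) * (v.1.1 * w.1.2 + v.1.2 * w.1.1)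
        + R (.inl 1) (.inl 1) * (v.1.2 * w.1.2)
        + (1 - 1 / B x.1 + x.1.2 * grad B x.1 1 / (2 * B x.1 ^ 2)
          - x.1.2 * grad A x.1 1 / (2 * A x.1 * B x.1)) * inner ℝ v.2 w.2 := by
    rw [ricci]
    have hi : inner ℝ v.2 w.2 = v.2 0 * w.2 0 + v.2 1 * w.2 1 := by
      erw [PiLp.inner_apply]
      simp [mul_comm]
    simp only [hric, hv, Fintype.sum_sum_type, Fin.sum_univ_two, hmix, hmix', htr, hrt, hθθ, hi]
    erw [stdBasis_repr_inl v 0, stdBasis_repr_inl v 1, stdBasis_repr_inl w 0,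
      stdBasis_repr_inl w 1, stdBasis_repr_inr v 0, stdBasis_repr_inr v 1, stdBasis_repr_inr w 0,
      stdBasis_repr_inr w 1]
    simp
    ring
  rw [stressEnergy, hs, hr, hg.form x hx, dSigmaSq_apply, htt, hrr]
  congr 1
  simp only [radius]
  field_simp
  ring

end Block

/-! ### Rotations -/

lemma det_reflection_span_singleton {n : E3} (hn : n ≠ 0) :
    LinearMap.det ((ℝ ∙ n).reflection.toLinearEquiv : E3 →ₗ[ℝ] E3) = 1 := by
  have h := (ℝ ∙ n).det_reflection
  rw [Submodule.finrank_orthogonal_span_singleton (n := 2) hn] at h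
  simpa using h

lemma reflection_span_singleton_of_inner_eq_zero {n s : E3} (h : inner ℝ s n = 0) :
    (ℝ ∙ n).reflection s = -s :=
  Submodule.reflection_mem_subspace_orthogonalComplement_eq_neg
    (Submodule.mem_orthogonal_singleton_iff_inner_left.2 h)

lemma reflection_span_singleton_self (n : E3) : (ℝ ∙ n).reflection n = n :=
  Submodule.reflection_mem_subspace_eq_self (Submodule.mem_span_singleton_self n)

lemma exists_rotation (σ σ' : S2) : ∃ A : E3 ≃ₗᵢ[ℝ] E3,
    LinearMap.det (A.toLinearEquiv : E3 →ₗ[ℝ] E3) = 1 ∧ A σ = σ' := by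
  by_cases h : (σ : E3) + σ' = 0
  · have hf : Module.finrank ℝ (ℝ ∙ (σ : E3))ᗮ = 2 :=
      Submodule.finrank_orthogonal_span_singleton (n := 2) (ne_zero_of_mem_unit_sphere σ)
    have hnt : Nontrivial (ℝ ∙ (σ : E3))ᗮ := Module.nontrivial_of_finrank_pos (R := ℝ) (by omega)
    obtain ⟨n, hn⟩ := exists_ne (0 : (ℝ ∙ (σ : E3))ᗮ)
    have hn' : (n : E3) ≠ 0 := by simpa using hn
    refine ⟨_, det_reflection_span_singleton hn', ?_⟩
    rw [reflection_span_singleton_of_inner_eq_zero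
      (Submodule.mem_orthogonal_singleton_iff_inner_right.1 n.2)]
    exact (eq_neg_of_add_eq_zero_right h).symm
  · refine ⟨_, det_reflection_span_singleton h, ?_⟩
    have h1 : (ℝ ∙ ((σ : E3) + σ')).reflection ((σ : E3) - σ') = -((σ : E3) - σ') := by
      apply reflection_span_singleton_of_inner_eq_zero
      simp [inner_sub_left, inner_add_right, real_inner_comm]
    have h2 := reflection_span_singleton_self ((σ : E3) + σ')
    have h3 : (σ : E3) = (1 / 2 : ℝ) • (((σ : E3) + σ') + ((σ : E3) - σ')) := by module
    have h4 := congrArg (ℝ ∙ ((σ : E3) + σ')).reflection h3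
    rw [map_smul, map_add, h1, h2] at h4
    rw [h4]
    module

lemma mdifferentiableAt_rotate (A : E3 ≃ₗᵢ[ℝ] E3) (x : Ambient) :
    MDifferentiableAt J J (rotate A) x := by
  have h : ContMDiff J 𝓘(ℝ, E3) ω fun y : Ambient => A (y.2 : E3) := by
    have h1 : ContMDiff J 𝓘(ℝ, E3) ω fun y : Ambient => (y.2 : E3) :=
      (contMDiff_coe_sphere (E := E3) (n := 2)).comp contMDiff_snd
    exact A.contDiff.contMDiff.comp h1
  have h2 : ContMDiff J (𝓡 2) ω fun y : Ambient => (rotate A y).2 :=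
    ContMDiff.codRestrict_sphere h fun y => (rotate A y).2.2
  have h3 : ContMDiff J J ω (rotate A) := contMDiff_fst.prodMk h2
  exact h3.mdifferentiableAt (by simp)

lemma mfderiv_rotate_fst (A : E3 ≃ₗᵢ[ℝ] E3) (x : Ambient) (v : TangentSpace J x) :
    (mfderiv J J (rotate A) x v).1 = v.1 := by
  have h := mfderiv_comp (I'' := 𝓘(ℝ, ℝ × ℝ)) (g := Prod.fst) x mdifferentiableAt_fst
    (mdifferentiableAt_rotate A x)
  have h1 := DFunLike.congr_fun h v
  have h2 := mfderiv_fst_apply (rotate A x) (mfderiv J J (rotate A) x v)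
  exact h2.symm.trans (h1.symm.trans (mfderiv_fst_apply x v))

lemma dSphere_mfderiv_rotate (A : E3 ≃ₗᵢ[ℝ] E3) (x : Ambient) (v : TangentSpace J x) :
    dSphere (rotate A x) (mfderiv J J (rotate A) x v) = A (dSphere x v) := by
  have h := mfderiv_comp x (mdifferentiableAt_coe_snd (rotate A x)) (mdifferentiableAt_rotate A x)
  have hA : DifferentiableAt ℝ A (x.2 : E3) := A.differentiable _
  have h' := mfderiv_comp (g := A) x hA.mdifferentiableAt (mdifferentiableAt_coe_snd x)
  have h1 := DFunLike.congr_fun h v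
  have h2 := DFunLike.congr_fun h' v
  have h3 : fderiv ℝ A (x.2 : E3) = (A.toContinuousLinearEquiv : E3 →L[ℝ] E3) :=
    A.toContinuousLinearEquiv.fderiv
  rw [mfderiv_eq_fderiv, h3] at h2
  exact h1.symm.trans h2

/-! ### Spherical symmetry implies the block form -/

section Symmetric

variable {t₀ t₁ r₀ r₁ : EReal} {g : MetricField}

lemma IsSphericallySymmetric.apply_eq_of_rotate (hg : IsSphericallySymmetric t₀ t₁ r₀ r₁ g)
    {A : E3 ≃ₗᵢ[ℝ] E3} (hA : LinearMap.det (A.toLinearEquiv : E3 →ₗ[ℝ] E3) = 1) {x y : Ambient}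
    (hx : x ∈ spaceTime t₀ t₁ r₀ r₁) (hy : rotate A x = y) {v w : TangentSpace J x}
    {v' w' : TangentSpace J y} (hv : v'.1 = v.1) (hw : w'.1 = w.1)
    (hv' : dSphere y v' = A (dSphere x v)) (hw' : dSphere y w' = A (dSphere x w)) :
    g y v' w' = g x v w := by
  subst hy
  have key : ∀ (v : TangentSpace J x) (v' : TangentSpace J (rotate A x)), v'.1 = v.1 →
      dSphere (rotate A x) v' = A (dSphere x v) → v' = mfderiv J J (rotate A) x v := by
    intro v v' h1 h2
    refine Prod.ext (h1.trans (mfderiv_rotate_fst A x v).symm) ?_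
    apply (tangentIsometry (rotate A x).2).injective
    rw [← dSphere_mfderiv_rotate, dSphere_apply, dSphere_apply] at h2
    exact h2
  rw [key v v' hv hv', key w w' hw hw']
  exact hg.invariant A hA x hx v w

/-- The vector at `x` tangent to the plane of `(t, r)` with components `a`. -/
def liftBase (x : Ambient) (a : ℝ × ℝ) : TangentSpace J x := ((a, 0) : (ℝ × ℝ) × E2)

/-- The vector at `x` tangent to the sphere with components `s`. -/
def liftSphere (x : Ambient) (s : E2) : TangentSpace J x := ((0, s) : (ℝ × ℝ) × E2)

lemma dSphere_liftBase (x : Ambient) (a : ℝ × ℝ) : dSphere x (liftBase x a) = 0 := by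
  rw [dSphere_apply]
  exact map_zero _

lemma IsSphericallySymmetric.liftBase_liftSphere (hg : IsSphericallySymmetric t₀ t₁ r₀ r₁ g)
    {x : Ambient} (hx : x ∈ spaceTime t₀ t₁ r₀ r₁) (a : ℝ × ℝ) (s : E2) :
    g x (liftBase x a) (liftSphere x s) = 0 := by
  have hx2 : (x.2 : E3) ≠ 0 := ne_zero_of_mem_unit_sphere x.2
  have hfix : rotate (ℝ ∙ (x.2 : E3)).reflection x = x :=
    Prod.ext rfl (Subtype.ext (reflection_span_singleton_self _))
  have h := hg.apply_eq_of_rotate (det_reflection_span_singleton hx2) hx hfix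
    (v := liftBase x a) (w := liftSphere x s) (v' := liftBase x a) (w' := -liftSphere x s) rfl
    (neg_zero) (by rw [dSphere_liftBase, map_zero]) (by
      rw [dSphere_apply, dSphere_apply, reflection_span_singleton_of_inner_eq_zero
        (inner_tangentIsometry _ _)]
      exact map_neg _ _)
  rw [map_neg] at h
  linarith

lemma IsSphericallySymmetric.liftBase_eq (hg : IsSphericallySymmetric t₀ t₁ r₀ r₁ g)
    {p : ℝ × ℝ} (hp : p ∈ rectangle t₀ t₁ r₀ r₁) (σ σ' : S2) (a b : ℝ × ℝ) :
    g (p, σ') (liftBase (p, σ') a) (liftBase (p, σ') b)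
      = g (p, σ) (liftBase (p, σ) a) (liftBase (p, σ) b) := by
  obtain ⟨A, hA, h⟩ := exists_rotation σ σ'
  have hy : rotate A (p, σ) = (p, σ') := Prod.ext rfl (Subtype.ext h)
  have h0 : ∀ a, dSphere (p, σ') (liftBase (p, σ') a) = A (dSphere (p, σ) (liftBase (p, σ) a)) := by
    intro a
    rw [dSphere_liftBase, dSphere_liftBase, map_zero]
  exact hg.apply_eq_of_rotate hA (x := (p, σ)) hp hy rfl rfl (h0 a) (h0 b)

lemma eq_coordT_add_coordR_add_liftSphere (x : Ambient) (v : TangentSpace J x) :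
    v = v.1.1 • coordT x + v.1.2 • coordR x + liftSphere x v.2 := by
  refine Prod.ext (Prod.ext ?_ ?_) ?_
  · change v.1.1 = v.1.1 * 1 + v.1.2 * 0 + 0
    ring
  · change v.1.2 = v.1.1 * 0 + v.1.2 * 1 + 0
    ring
  · change v.2 = v.1.1 • (0 : E2) + v.1.2 • (0 : E2) + v.2
    simp

lemma IsSphericallySymmetric.coordR_pos (hg : IsSphericallySymmetric t₀ t₁ r₀ r₁ g)
    {x : Ambient} (hx : x ∈ spaceTime t₀ t₁ r₀ r₁) : 0 < g x (coordR x) (coordR x) := by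
  obtain ⟨hsymm, n, -, hpos⟩ := hg.lorentzian x hx
  have hT := hg.timelike x hx
  have hTR := hg.orthogonal x hx
  have hRT : g x (coordR x) (coordT x) = 0 := by rw [hsymm, hTR]
  have hT0 : coordT x ≠ 0 := by
    intro h
    rw [h] at hT
    simp at hT
  have hnT : g x n (coordT x) ≠ 0 := fun h => (hpos _ hT0 h).not_gt hT
  set w : TangentSpace J x := g x n (coordR x) • coordT x - g x n (coordT x) • coordR x with hw
  have hw0 : w ≠ 0 := by
    intro h
    have h1 : w.1.2 = 0 := congrArg (fun v : (ℝ × ℝ) × E2 => v.1.2) h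
    have h2 : w.1.2 = g x n (coordR x) * 0 - g x n (coordT x) * 1 := rfl
    rw [h2] at h1
    apply hnT
    linarith
  have h1 := hpos w hw0 (by simp [hw, mul_comm])
  have h2 : g x w w = g x n (coordR x) ^ 2 * g x (coordT x) (coordT x)
      + g x n (coordT x) ^ 2 * g x (coordR x) (coordR x) := by
    simp [hw, hTR, hRT]
    ring
  rw [h2] at h1
  by_contra hle
  nlinarith [sq_nonneg (g x n (coordR x)), sq_nonneg (g x n (coordT x))]

lemma mfderiv_symm_liftBase (x : Ambient) (u : (ℝ × ℝ) × E2) (a : ℝ × ℝ) :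
    mfderiv 𝓘(ℝ, (ℝ × ℝ) × E2) J (extChartAt J x).symm u ((a, 0) : (ℝ × ℝ) × E2)
      = liftBase ((extChartAt J x).symm u) a := by
  have h0 := dSphere_mfderiv_symm x u (a, 0)
  rw [map_zero, dSphere_apply] at h0
  have h1 := dBase_mfderiv_symm x (f := Prod.fst) u (a, 0) differentiableAt_fst
  rw [dBase_apply _ _ differentiableAt_fst, fderiv_fst, fderiv_fst] at h1
  have h2 := dBase_mfderiv_symm x (f := Prod.snd) u (a, 0) differentiableAt_snd
  rw [dBase_apply _ _ differentiableAt_snd, fderiv_snd, fderiv_snd] at h2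
  refine Prod.ext (Prod.ext h1 h2) ?_
  apply (tangentIsometry ((extChartAt J x).symm u).2).injective
  exact h0.trans (map_zero _).symm

lemma IsSphericallySymmetric.contDiffOn_liftBase (hg : IsSphericallySymmetric t₀ t₁ r₀ r₁ g)
    (σ : S2) (i : Fin 2) :
    ContDiffOn ℝ ∞ (fun p : ℝ × ℝ => g (p, σ) (liftBase (p, σ) (dir i)) (liftBase (p, σ) (dir i)))
      (rectangle t₀ t₁ r₀ r₁) := by
  intro p hp
  have h := hg.smooth (p, σ) hp (.inl i) (.inl i)
  rw [extChartAt_apply_self] at h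
  have h1 := h.comp (f := fun q : ℝ × ℝ => (q, (0 : E2))) p
    (contDiff_id.prodMk contDiff_const).contDiffAt
  refine (h1.congr_of_eventuallyEq ?_).contDiffWithinAt
  filter_upwards [(isOpen_rectangle _ _ _ _).mem_nhds hp] with q hq
  rw [Function.comp_apply, chartMatrix, Matrix.of_apply, stdBasis_inl, mfderiv_symm_liftBase,
    extChartAt_symm_apply]
  exact hg.liftBase_eq hq _ _ _ _

theorem IsSphericallySymmetric.exists_isBlockMetric (hg : IsSphericallySymmetric t₀ t₁ r₀ r₁ g) :
    ∃ A B : ℝ × ℝ → ℝ, IsBlockMetric t₀ t₁ r₀ r₁ g A B := by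
  obtain ⟨σ⟩ : Nonempty S2 := ⟨⟨EuclideanSpace.single 0 1, by simp⟩⟩
  refine ⟨fun p => -g (p, σ) (coordT (p, σ)) (coordT (p, σ)),
    fun p => g (p, σ) (coordR (p, σ)) (coordR (p, σ)), ?_, (hg.contDiffOn_liftBase σ 0).neg,
    hg.contDiffOn_liftBase σ 1, fun p hp => neg_pos.2 (hg.timelike (p, σ) hp),
    fun p hp => hg.coordR_pos (x := (p, σ)) hp⟩
  intro x hx v w
  have hsymm := (hg.lorentzian x hx).1
  have hTR := hg.orthogonal x hx
  have hRT : g x (coordR x) (coordT x) = 0 := by rw [hsymm, hTR]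
  have hTS : ∀ s, g x (coordT x) (liftSphere x s) = 0 := hg.liftBase_liftSphere hx _
  have hRS : ∀ s, g x (coordR x) (liftSphere x s) = 0 := hg.liftBase_liftSphere hx _
  have hST : ∀ s, g x (liftSphere x s) (coordT x) = 0 := fun s => by rw [hsymm, hTS]
  have hSR : ∀ s, g x (liftSphere x s) (coordR x) = 0 := fun s => by rw [hsymm, hRS]
  have hSS : g x (liftSphere x v.2) (liftSphere x w.2) = radius x ^ 2 * dSigmaSq x v w := by
    rw [hg.round x hx _ (mem_tangentS.2 rfl) _ (mem_tangentS.2 rfl), dSigmaSq_apply,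
      dSigmaSq_apply]
    rfl
  have hT : g (x.1, σ) (coordT (x.1, σ)) (coordT (x.1, σ)) = g x (coordT x) (coordT x) :=
    hg.liftBase_eq hx x.2 σ _ _
  have hR : g (x.1, σ) (coordR (x.1, σ)) (coordR (x.1, σ)) = g x (coordR x) (coordR x) :=
    hg.liftBase_eq hx x.2 σ _ _
  beta_reduce
  rw [hT, hR, ← hSS]
  conv_lhs => rw [eq_coordT_add_coordR_add_liftSphere x v, eq_coordT_add_coordR_add_liftSphere x w]
  simp [hTR, hRT, hTS, hRS, hST, hSR]
  ring

end Symmetric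

/-! ### Functions on intervals -/

lemma exists_mem_openInterval {a b : EReal} (h : a < b) : ∃ s, s ∈ openInterval a b :=
  EReal.lt_iff_exists_real_btwn.1 h

lemma ordConnected_openInterval (a b : EReal) : (openInterval a b).OrdConnected :=
  ⟨fun _ hx _ hy _ hz => ⟨hx.1.trans_le (by exact_mod_cast hz.1),
    lt_of_le_of_lt (by exact_mod_cast hz.2) hy.2⟩⟩

section Primitive

variable {a b : EReal} {q : ℝ → ℝ}

lemma hasDerivAt_primitive (hq : ContDiffOn ℝ ∞ q (openInterval a b)) {s t : ℝ}
    (hs : s ∈ openInterval a b) (ht : t ∈ openInterval a b) :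
    HasDerivAt (fun t => ∫ x in s..t, q x) (q t) t := by
  have hsub : Set.uIcc s t ⊆ openInterval a b := (ordConnected_openInterval a b).uIcc_subset hs ht
  have hnhds := (isOpen_openInterval a b).mem_nhds ht
  exact intervalIntegral.integral_hasDerivAt_right (hq.continuousOn.mono hsub).intervalIntegrable
    (hq.continuousOn.stronglyMeasurableAtFilter (isOpen_openInterval a b) t ht)
    (hq.continuousOn.continuousAt hnhds)

lemma contDiffOn_of_hasDerivAt {F : ℝ → ℝ} (hq : ContDiffOn ℝ ∞ q (openInterval a b))
    (hF : ∀ t ∈ openInterval a b, HasDerivAt F (q t) t) : ContDiffOn ℝ ∞ F (openInterval a b) := by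
  rw [contDiffOn_infty_iff_deriv_of_isOpen (isOpen_openInterval a b)]
  exact ⟨fun t ht => (hF t ht).differentiableAt.differentiableWithinAt,
    hq.congr fun t ht => (hF t ht).deriv⟩

lemma eq_of_hasDerivAt_zero {F : ℝ → ℝ} (hF : ∀ t ∈ openInterval a b, HasDerivAt F 0 t) {s t : ℝ}
    (hs : s ∈ openInterval a b) (ht : t ∈ openInterval a b) : F s = F t :=
  (isOpen_openInterval a b).is_const_of_deriv_eq_zero
    (ordConnected_openInterval a b).isPreconnected
    (fun t ht => (hF t ht).differentiableAt.differentiableWithinAt)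
    (fun t ht => (hF t ht).deriv) hs ht

end Primitive

/-! ### The function `h` -/

section HFun

variable {r₀ r₁ : EReal} {m : ℝ → ℝ} {c rs : ℝ}

lemma hasDerivAt_massIntegral (hm : ContDiffOn ℝ ∞ m (openInterval r₀ r₁))
    (hrs : rs ∈ openInterval r₀ r₁) {r : ℝ} (hr : r ∈ openInterval r₀ r₁) :
    HasDerivAt (massIntegral m rs) (4 * Real.pi * r ^ 2 * m r) r :=
  hasDerivAt_primitive (((contDiff_const.mul (contDiff_id.pow 2)).contDiffOn).mul hm) hrs hr

lemma hasDerivAt_hFun (hr₀ : 0 ≤ r₀) (hm : ContDiffOn ℝ ∞ m (openInterval r₀ r₁))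
    (hrs : rs ∈ openInterval r₀ r₁) {r : ℝ} (hr : r ∈ openInterval r₀ r₁) :
    HasDerivAt (hFun m c rs) ((1 - hFun m c rs r) / r - 8 * Real.pi * r * m r) r := by
  have hr' := (pos_of_mem_openInterval hr₀ hr).ne'
  have h1 := ((hasDerivAt_id r).add_const c).div (hasDerivAt_id r) hr'
  have h2 := ((hasDerivAt_const r (2 : ℝ)).div (hasDerivAt_id r) hr').mul
    (hasDerivAt_massIntegral hm hrs hr)
  refine (h1.sub h2).congr_deriv ?_
  simp [hFun]
  field_simp
  ring

lemma hFun_pos (hr₀ : 0 ≤ r₀) {r : ℝ} (hr : r ∈ openInterval r₀ r₁)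
    (h : massIntegral m rs r < (r + c) / 2) : 0 < hFun m c rs r := by
  have hr' := pos_of_mem_openInterval hr₀ hr
  have : hFun m c rs r = (r + c - 2 * massIntegral m rs r) / r := by
    rw [hFun]
    ring
  rw [this]
  apply div_pos _ hr'
  linarith

lemma contDiffOn_hFun (hr₀ : 0 ≤ r₀) (hm : ContDiffOn ℝ ∞ m (openInterval r₀ r₁))
    (hrs : rs ∈ openInterval r₀ r₁) : ContDiffOn ℝ ∞ (hFun m c rs) (openInterval r₀ r₁) := by
  have h1 : ContDiffOn ℝ ∞ (massIntegral m rs) (openInterval r₀ r₁) :=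
    contDiffOn_of_hasDerivAt (((contDiff_const.mul (contDiff_id.pow 2)).contDiffOn).mul hm)
      fun t ht => hasDerivAt_massIntegral hm hrs ht
  have h0 : ∀ r ∈ openInterval r₀ r₁, r ≠ 0 := fun r hr => (pos_of_mem_openInterval hr₀ hr).ne'
  exact ((contDiffOn_id.add contDiffOn_const).div contDiffOn_id h0).sub
    ((contDiffOn_const.div contDiffOn_id h0).mul h1)

lemma hasDerivAt_deriv_hFun (hr₀ : 0 ≤ r₀) (hm : ContDiffOn ℝ ∞ m (openInterval r₀ r₁))
    (hrs : rs ∈ openInterval r₀ r₁) {r : ℝ} (hr : r ∈ openInterval r₀ r₁) :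
    HasDerivAt (fun r => (1 - hFun m c rs r) / r - 8 * Real.pi * r * m r)
      (-2 * (1 - hFun m c rs r) / r ^ 2 - 8 * Real.pi * r * deriv m r) r := by
  have hr' := (pos_of_mem_openInterval hr₀ hr).ne'
  have hmr : HasDerivAt m (deriv m r) r :=
    ((hm.contDiffAt ((isOpen_openInterval _ _).mem_nhds hr)).differentiableAt (by simp)).hasDerivAt
  have h1 := ((hasDerivAt_hFun (c := c) hr₀ hm hrs hr).const_sub 1).div (hasDerivAt_id r) hr'
  have h2 := ((hasDerivAt_id r).const_mul (8 * Real.pi)).mul hmr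
  refine (h1.sub h2).congr_deriv ?_
  simp
  field_simp
  ring

/-- Every smooth `h` is of the form `hFun m c rs`. -/
lemma hFun_eq (hr₀ : 0 ≤ r₀) {h : ℝ → ℝ} (hh : ContDiffOn ℝ ∞ h (openInterval r₀ r₁))
    (hm : ∀ r ∈ openInterval r₀ r₁, 8 * Real.pi * r ^ 2 * m r = 1 - h r - r * deriv h r)
    (hms : ContDiffOn ℝ ∞ m (openInterval r₀ r₁))
    (hrs : rs ∈ openInterval r₀ r₁) {r : ℝ} (hr : r ∈ openInterval r₀ r₁) :
    hFun m (rs * h rs - rs) rs r = h r := by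
  have hr' := (pos_of_mem_openInterval hr₀ hr).ne'
  have hd : ∀ x ∈ openInterval r₀ r₁,
      HasDerivAt (fun x => 2 * massIntegral m rs x - (x - x * h x)) 0 x := by
    intro x hx
    have hhx : HasDerivAt h (deriv h x) x :=
      ((hh.contDiffAt ((isOpen_openInterval _ _).mem_nhds hx)).differentiableAt
        (by simp)).hasDerivAt
    refine (((hasDerivAt_massIntegral hms hrs hx).const_mul 2).sub
      ((hasDerivAt_id x).sub ((hasDerivAt_id x).mul hhx))).congr_deriv ?_
    have := hm x hx
    simp
    linarith
  have h1 := eq_of_hasDerivAt_zero hd hrs hr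
  simp only [massIntegral, intervalIntegral.integral_same] at h1
  rw [hFun, massIntegral]
  field_simp
  linarith

end HFun

/-! ### Block metrics are spherically symmetric -/

section Block

variable {t₀ t₁ r₀ r₁ : EReal} {g : MetricField} {A B : ℝ × ℝ → ℝ}

lemma IsBlockMetric.congr (hg : IsBlockMetric t₀ t₁ r₀ r₁ g A B) {A' B' : ℝ × ℝ → ℝ}
    (hA : Set.EqOn A' A (rectangle t₀ t₁ r₀ r₁)) (hB : Set.EqOn B' B (rectangle t₀ t₁ r₀ r₁)) :
    IsBlockMetric t₀ t₁ r₀ r₁ g A' B' where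
  form x hx v w := by rw [hg.form x hx, hA hx, hB hx]
  smooth_A := hg.smooth_A.congr hA
  smooth_B := hg.smooth_B.congr hB
  pos_A p hp := by rw [hA hp]; exact hg.pos_A p hp
  pos_B p hp := by rw [hB hp]; exact hg.pos_B p hp

theorem IsBlockMetric.isSphericallySymmetric (hg : IsBlockMetric t₀ t₁ r₀ r₁ g A B)
    (hr₀ : 0 ≤ r₀) : IsSphericallySymmetric t₀ t₁ r₀ r₁ g where
  smooth x hx i j := by
    rw [extChartAt_apply_self]
    have hU : Prod.fst ⁻¹' rectangle t₀ t₁ r₀ r₁ ∈ nhds (x.1, (0 : E2)) :=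
      ((isOpen_rectangle _ _ _ _).preimage continuous_fst).mem_nhds hx
    have h1 : (fun u => chartMatrix stdBasis g x u i j) =ᶠ[nhds (x.1, (0 : E2))]
        fun u => if i = j then baseFactor A B i u.1 * sphereFactor i u.2 else 0 := by
      filter_upwards [hU] with u hu
      rw [chartMatrix_block hg.form x hu, Matrix.diagonal_apply]
    refine ContDiffAt.congr_of_eventuallyEq ?_ h1
    split_ifs
    · exact (contDiffOn_entry hg.smooth_A hg.smooth_B i).contDiffAt hU
    · exact contDiffAt_const
  lorentzian x hx := by
    have hr : 0 < radius x := pos_of_mem_openInterval hr₀ hx.2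
    have hA := hg.pos_A _ hx
    have hB := hg.pos_B _ hx
    refine ⟨fun v w => ?_, coordT x, ?_, fun w hw h => ?_⟩
    · rw [hg.form x hx, hg.form x hx, dSigmaSq, dSigmaSq, real_inner_comm]
      ring
    · rw [hg.form x hx, dSigmaSq_apply]
      simp [coordT, hA]
    · rw [hg.form x hx, dSigmaSq_apply] at h
      simp [coordT, hA.ne'] at h
      rw [hg.form x hx, dSigmaSq_apply, h]
      have h2 : 0 ≤ B x.1 * (w.1.2 * w.1.2) := mul_nonneg hB.le (mul_self_nonneg _)
      have h3 : (0 : ℝ) ≤ radius x ^ 2 * inner ℝ w.2 w.2 :=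
        mul_nonneg (sq_nonneg _) real_inner_self_nonneg
      by_contra hle
      have h4 : B x.1 * (w.1.2 * w.1.2) = 0 := by linarith
      have h5 : radius x ^ 2 * inner ℝ w.2 w.2 = 0 := by linarith
      apply hw
      refine Prod.ext (Prod.ext h ?_) ?_
      · have h6 : w.1.2 = 0 := by simpa [hB.ne'] using h4
        exact h6
      · have h6 : w.2 = 0 := by simpa [hr.ne'] using h5
        exact h6
  invariant R _ x hx v w := by
    have hx' : rotate R x ∈ spaceTime t₀ t₁ r₀ r₁ := hx
    rw [hg.form _ hx', hg.form x hx, dSigmaSq, dSigmaSq, dSphere_mfderiv_rotate,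
      dSphere_mfderiv_rotate, LinearIsometryEquiv.inner_map_map]
    erw [mfderiv_rotate_fst, mfderiv_rotate_fst]
    rfl
  round x hx s hs s' hs' := by
    rw [mem_tangentS] at hs hs'
    rw [hg.form x hx, hs, hs']
    simp
  orthogonal x hx := by
    rw [hg.form x hx, dSigmaSq_apply]
    simp [coordT, coordR]
  timelike x hx := by
    rw [hg.form x hx, dSigmaSq_apply]
    simp [coordT, hg.pos_A _ hx]

lemma IsBlockMetric.mem_tangentR (hg : IsBlockMetric t₀ t₁ r₀ r₁ g A B) (hr₀ : 0 ≤ r₀)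
    {x : Ambient} (hx : x ∈ spaceTime t₀ t₁ r₀ r₁) {v : TangentSpace J x} :
    v ∈ tangentR g x ↔ v.2 = 0 := by
  have hr : 0 < radius x := pos_of_mem_openInterval hr₀ hx.2
  constructor
  · intro h
    have h1 := h (liftSphere x v.2) (mem_tangentS.2 rfl)
    rw [hg.form x hx, dSigmaSq_apply] at h1
    simpa [liftSphere, hr.ne'] using h1
  · intro h s hs
    rw [mem_tangentS] at hs
    rw [hg.form x hx, dSigmaSq_apply, hs, h]
    simp

lemma grad_mul_zero {f k : ℝ → ℝ} {p : ℝ × ℝ} (hf : DifferentiableAt ℝ f p.1)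
    (hk : DifferentiableAt ℝ k p.2) : grad (fun q => f q.1 * k q.2) p 0 = deriv f p.1 * k p.2 := by
  have h : HasFDerivAt (fun q : ℝ × ℝ => f q.1 * k q.2) _ p :=
    (hf.hasDerivAt.comp_hasFDerivAt p (hasFDerivAt_fst (𝕜 := ℝ) (p := p))).mul
      (hk.hasDerivAt.comp_hasFDerivAt p (hasFDerivAt_snd (𝕜 := ℝ) (p := p)))
  rw [grad, h.fderiv]
  simp [dir, mul_comm]

lemma grad_mul_one {f k : ℝ → ℝ} {p : ℝ × ℝ} (hf : DifferentiableAt ℝ f p.1)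
    (hk : DifferentiableAt ℝ k p.2) : grad (fun q => f q.1 * k q.2) p 1 = f p.1 * deriv k p.2 := by
  have h : HasFDerivAt (fun q : ℝ × ℝ => f q.1 * k q.2) _ p :=
    (hf.hasDerivAt.comp_hasFDerivAt p (hasFDerivAt_fst (𝕜 := ℝ) (p := p))).mul
      (hk.hasDerivAt.comp_hasFDerivAt p (hasFDerivAt_snd (𝕜 := ℝ) (p := p)))
  rw [grad, h.fderiv]
  simp [dir]

lemma grad_congr {F F' : ℝ × ℝ → ℝ} {p : ℝ × ℝ} (h : F =ᶠ[nhds p] F') (i : Fin 2) :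
    grad F p i = grad F' p i := by
  rw [grad, grad, h.fderiv_eq]

theorem hasStressEnergy_static {m f : ℝ → ℝ} {c rs : ℝ} (hr₀ : 0 ≤ r₀)
    (hm : ContDiffOn ℝ ∞ m (openInterval r₀ r₁)) (hrs : rs ∈ openInterval r₀ r₁)
    (hf : ContDiffOn ℝ ∞ f (openInterval t₀ t₁))
    (hg : IsBlockMetric t₀ t₁ r₀ r₁ g (fun p => f p.1 * hFun m c rs p.2)
      (fun p => (hFun m c rs p.2)⁻¹)) :
    HasStressEnergy t₀ t₁ r₀ r₁ g (fun x => m (radius x))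
      (fun x => -m (radius x) - radius x / 2 * deriv m (radius x)) := by
  intro x hx v hv v' hv' s hs s' hs'
  have hopen := isOpen_rectangle t₀ t₁ r₀ r₁
  rw [hg.mem_tangentR hr₀ hx] at hv hv'
  rw [mem_tangentS] at hs hs'
  have hr : 0 < x.1.2 := pos_of_mem_openInterval hr₀ hx.2
  have hpos : 0 < hFun m c rs x.1.2 := inv_pos.1 (hg.pos_B _ hx)
  have hfx : 0 < f x.1.1 := (mul_pos_iff_of_pos_right hpos).1 (hg.pos_A _ hx)
  have hdf : ∀ t ∈ openInterval t₀ t₁, DifferentiableAt ℝ f t := fun t ht =>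
    (hf.contDiffAt ((isOpen_openInterval _ _).mem_nhds ht)).differentiableAt (by simp)
  have hh := fun r (hr : r ∈ openInterval r₀ r₁) => hasDerivAt_hFun (c := c) hr₀ hm hrs hr
  have hh' := hasDerivAt_deriv_hFun (c := c) hr₀ hm hrs hx.2
  have hgA : ∀ p ∈ rectangle t₀ t₁ r₀ r₁, grad (fun p => f p.1 * hFun m c rs p.2) p 1
      = f p.1 * ((1 - hFun m c rs p.2) / p.2 - 8 * Real.pi * p.2 * m p.2) := by
    intro p hp
    rw [grad_mul_one (hdf _ hp.1) (hh _ hp.2).differentiableAt, (hh _ hp.2).deriv]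
  have hhA : hess (fun p => f p.1 * hFun m c rs p.2) x.1 1 1
      = f x.1.1 * (-2 * (1 - hFun m c rs x.1.2) / x.1.2 ^ 2
        - 8 * Real.pi * x.1.2 * deriv m x.1.2) := by
    rw [hess, grad_congr (Filter.eventually_of_mem (hopen.mem_nhds hx) hgA),
      grad_mul_one (k := fun r => (1 - hFun m c rs r) / r - 8 * Real.pi * r * m r)
        (hdf _ hx.1) hh'.differentiableAt, hh'.deriv]
  have hB : (fun p : ℝ × ℝ => (hFun m c rs p.2)⁻¹)
      = fun p => (fun _ => (1 : ℝ)) p.1 * (fun r => (hFun m c rs r)⁻¹) p.2 := by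
    ext p
    simp
  have hinv : ∀ p ∈ rectangle t₀ t₁ r₀ r₁, HasDerivAt (fun r => (hFun m c rs r)⁻¹) _ p.2 :=
    fun p hp => (hh p.2 hp.2).fun_inv (inv_pos.1 (hg.pos_B _ hp)).ne'
  have hgB0 : ∀ p ∈ rectangle t₀ t₁ r₀ r₁, grad (fun p => (hFun m c rs p.2)⁻¹) p 0 = 0 := by
    intro p hp
    rw [hB, grad_mul_zero (differentiableAt_const _) (hinv p hp).differentiableAt]
    simp
  have hgB1 : grad (fun p => (hFun m c rs p.2)⁻¹) x.1 1
      = -((1 - hFun m c rs x.1.2) / x.1.2 - 8 * Real.pi * x.1.2 * m x.1.2)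
        / hFun m c rs x.1.2 ^ 2 := by
    rw [hB, grad_mul_one (differentiableAt_const _) (hinv _ hx).differentiableAt, (hinv _ hx).deriv,
      one_mul]
  have hhB : hess (fun p => (hFun m c rs p.2)⁻¹) x.1 0 0 = 0 := by
    rw [hess, grad_congr (Filter.eventually_of_mem (hopen.mem_nhds hx) hgB0)]
    simp [grad]
  have hv1 : (v + s).1 = v.1 := by
    change v.1 + s.1 = v.1
    rw [hs]
    exact add_zero _
  have hv1' : (v' + s').1 = v'.1 := by
    change v'.1 + s'.1 = v'.1
    rw [hs']
    exact add_zero _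
  have hv2 : (v + s).2 = s.2 := by
    change v.2 + s.2 = s.2
    rw [hv]
    exact zero_add _
  have hv2' : (v' + s').2 = s'.2 := by
    change v'.2 + s'.2 = s'.2
    rw [hv']
    exact zero_add _
  rw [stressEnergy_block hg hr₀ hx, hv1, hv1', hv2, hv2', hg.form x hx, hg.form x hx,
    dSigmaSq_apply, dSigmaSq_apply, hgA _ hx, hgB0 _ hx, hgB1, hhA, hhB, hv, hs, hs']
  simp only [radius]
  have hπ := Real.pi_ne_zero
  generalize inner ℝ s.2 s'.2 = S
  simp
  field_simp
  ring

theorem isBlockMetric_of_hasStaticForm {m : ℝ → ℝ} {c rs : ℝ} (hr₀ : 0 ≤ r₀)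
    (hm : ContDiffOn ℝ ∞ m (openInterval r₀ r₁)) (hrs : rs ∈ openInterval r₀ r₁)
    (hc : ∀ r ∈ openInterval r₀ r₁, massIntegral m rs r < (r + c) / 2)
    (hg : HasStaticForm t₀ t₁ r₀ r₁ g (hFun m c rs) Prod.fst) :
    IsBlockMetric t₀ t₁ r₀ r₁ g (fun p => (fun _ => 1) p.1 * hFun m c rs p.2)
      (fun p => (hFun m c rs p.2)⁻¹) := by
  have hpos : ∀ r ∈ openInterval r₀ r₁, 0 < hFun m c rs r := fun r hr => hFun_pos hr₀ hr (hc r hr)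
  have hs : ContDiffOn ℝ ∞ (fun p : ℝ × ℝ => hFun m c rs p.2) (rectangle t₀ t₁ r₀ r₁) :=
    (contDiffOn_hFun hr₀ hm hrs).comp contDiff_snd.contDiffOn fun p hp => hp.2
  refine ⟨fun x hx v w => ?_, contDiffOn_const.mul hs, hs.inv fun p hp => (hpos _ hp.2).ne',
    fun p hp => ?_, fun p hp => inv_pos.2 (hpos _ hp.2)⟩
  · have h1 : ∀ v, dBase Prod.fst x v = v.1.1 := fun v => by
      rw [dBase_apply _ _ differentiableAt_fst, fderiv_fst]
      rfl
    have h2 : ∀ v, dBase Prod.snd x v = v.1.2 := fun v => by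
      rw [dBase_apply _ _ differentiableAt_snd, fderiv_snd]
      rfl
    rw [hg x hx, h1, h1, h2, h2]
    simp [radius]
  · simpa using hpos _ hp.2

end Block

/-! ### Time coordinates -/

section Time

variable {a b : EReal} {F q : ℝ → ℝ}

lemma exists_image_eq_openInterval (hF : StrictMonoOn F (openInterval a b))
    (hc : ContinuousOn F (openInterval a b)) :
    ∃ τ₀ τ₁ : EReal, F '' openInterval a b = openInterval τ₀ τ₁ := by
  have hconn : (F '' openInterval a b).OrdConnected :=
    (((ordConnected_openInterval a b).isPreconnected).image F hc).ordConnected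
  refine ⟨sInf ((fun t => (F t : EReal)) '' openInterval a b),
    sSup ((fun t => (F t : EReal)) '' openInterval a b), Set.Subset.antisymm ?_ ?_⟩
  · rintro _ ⟨t, ht, rfl⟩
    obtain ⟨s, hs, hst⟩ := EReal.lt_iff_exists_real_btwn.1 ht.1
    obtain ⟨s', hts', hs'⟩ := EReal.lt_iff_exists_real_btwn.1 ht.2
    have hsI : s ∈ openInterval a b := ⟨hs, hst.trans ht.2⟩
    have hsI' : s' ∈ openInterval a b := ⟨ht.1.trans hts', hs'⟩
    constructor
    · refine (sInf_le (Set.mem_image_of_mem _ hsI)).trans_lt ?_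
      exact_mod_cast hF hsI ht (by exact_mod_cast hst)
    · refine lt_of_lt_of_le ?_ (le_sSup (Set.mem_image_of_mem _ hsI'))
      exact_mod_cast hF ht hsI' (by exact_mod_cast hts')
  · rintro y ⟨hy, hy'⟩
    obtain ⟨_, ⟨s, hs, rfl⟩, hsy⟩ := sInf_lt_iff.1 hy
    obtain ⟨_, ⟨s', hs', rfl⟩, hsy'⟩ := lt_sSup_iff.1 hy'
    exact hconn.out (Set.mem_image_of_mem F hs) (Set.mem_image_of_mem F hs')
      ⟨EReal.coe_le_coe_iff.1 hsy.le, EReal.coe_le_coe_iff.1 hsy'.le⟩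

lemma hasFDerivAt_comp_fst {p : ℝ × ℝ} {d : ℝ} (hF : HasDerivAt F d p.1) :
    HasFDerivAt (fun p : ℝ × ℝ => F p.1) (d • ContinuousLinearMap.fst ℝ ℝ ℝ) p :=
  hF.comp_hasFDerivAt p (hasFDerivAt_fst (𝕜 := ℝ) (p := p))

lemma exists_isTimeCoordinate {t₀ t₁ : EReal} (r₀ r₁ : EReal)
    (hq : ContDiffOn ℝ ∞ q (openInterval t₀ t₁))
    (hpos : ∀ t ∈ openInterval t₀ t₁, 0 < q t)
    (hF : ∀ t ∈ openInterval t₀ t₁, HasDerivAt F (q t) t) :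
    ∃ τ₀ τ₁, IsTimeCoordinate t₀ t₁ r₀ r₁ τ₀ τ₁ fun p => F p.1 := by
  have hs := contDiffOn_of_hasDerivAt hq hF
  have hmono : StrictMonoOn F (openInterval t₀ t₁) := by
    refine strictMonoOn_of_deriv_pos (ordConnected_openInterval t₀ t₁).convex hs.continuousOn ?_
    intro t ht
    rw [(isOpen_openInterval t₀ t₁).interior_eq] at ht
    rw [(hF t ht).deriv]
    exact hpos t ht
  obtain ⟨τ₀, τ₁, himage⟩ := exists_image_eq_openInterval hmono hs.continuousOn
  refine ⟨τ₀, τ₁, hs.comp contDiff_fst.contDiffOn fun p hp => hp.1, fun p hp => ?_, ?_, ?_, ?_⟩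
  · rw [(hasFDerivAt_comp_fst (hF _ hp.1)).fderiv]
    simpa using hpos _ hp.1
  · intro p hp
    exact ⟨himage ▸ Set.mem_image_of_mem F hp.1, hp.2⟩
  · intro p hp p' hp' h
    have h' := Prod.mk.inj h
    exact Prod.ext (hmono.injOn hp.1 hp'.1 h'.1) h'.2
  · rintro ⟨y, r⟩ ⟨hy, hr⟩
    rw [← himage] at hy
    obtain ⟨t, ht, rfl⟩ := hy
    exact ⟨(t, r), ⟨ht, hr⟩, rfl⟩

end Time

/-! ### The static form of a metric with stress-energy tensor `-μ g_R + lam g_S` -/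

section Static

variable {t₀ t₁ r₀ r₁ : EReal} {g : MetricField} {A B : ℝ × ℝ → ℝ} {μ lam : Ambient → ℝ}

lemma hasDerivAt_fst_slice {f : ℝ × ℝ → ℝ} {p : ℝ × ℝ} (hf : DifferentiableAt ℝ f p) :
    HasDerivAt (fun t => f (t, p.2)) (grad f p 0) p.1 :=
  HasFDerivAt.comp_hasDerivAt (l := f) (f := fun t => (t, p.2)) p.1 hf.hasFDerivAt
    ((hasDerivAt_id p.1).prodMk (hasDerivAt_const _ _))

lemma hasDerivAt_snd_slice {f : ℝ × ℝ → ℝ} {p : ℝ × ℝ} (hf : DifferentiableAt ℝ f p) :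
    HasDerivAt (fun r => f (p.1, r)) (grad f p 1) p.2 :=
  HasFDerivAt.comp_hasDerivAt (l := f) (f := fun r => (p.1, r)) p.2 hf.hasFDerivAt
    ((hasDerivAt_const _ _).prodMk (hasDerivAt_id p.2))

lemma HasStressEnergy.grad_eq (hg : IsBlockMetric t₀ t₁ r₀ r₁ g A B) (hr₀ : 0 ≤ r₀)
    (hT : HasStressEnergy t₀ t₁ r₀ r₁ g μ lam) {p : ℝ × ℝ} (hp : p ∈ rectangle t₀ t₁ r₀ r₁) :
    grad B p 0 = 0 ∧ grad A p 1 * B p + A p * grad B p 1 = 0 := by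
  obtain ⟨σ⟩ : Nonempty S2 := ⟨⟨EuclideanSpace.single 0 1, by simp⟩⟩
  have hx : (p, σ) ∈ spaceTime t₀ t₁ r₀ r₁ := hp
  have hcT : coordT (p, σ) ∈ tangentR g (p, σ) := (hg.mem_tangentR hr₀ hx).2 rfl
  have hcR : coordR (p, σ) ∈ tangentR g (p, σ) := (hg.mem_tangentR hr₀ hx).2 rfl
  have h0 : (0 : TangentSpace J (p, σ)) ∈ tangentS (p, σ) := mem_tangentS.2 rfl
  have hA := (hg.pos_A _ hp).ne'
  have hB := (hg.pos_B _ hp).ne'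
  have hr := (pos_of_mem_openInterval hr₀ hp.2).ne'
  have hπ := Real.pi_ne_zero
  have htr := hT _ hx _ hcT _ hcR _ h0 _ h0
  have htt := hT _ hx _ hcT _ hcT _ h0 _ h0
  have hrr := hT _ hx _ hcR _ hcR _ h0 _ h0
  simp only [add_zero, map_zero, mul_zero, stressEnergy_block hg hr₀ hx, hg.form _ hx,
    dSigmaSq_apply] at htr htt hrr
  simp [coordT, coordR, hB, hr, hπ] at htr htt hrr
  refine ⟨htr, ?_⟩
  field_simp at htt hrr
  apply mul_left_cancel₀ hr
  linear_combination B p * hrr + A p * htt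

/-- The stress-energy tensor determines the functions `μ` and `lam`. -/
lemma HasStressEnergy.unique (hg : IsBlockMetric t₀ t₁ r₀ r₁ g A B) (hr₀ : 0 ≤ r₀)
    (hT : HasStressEnergy t₀ t₁ r₀ r₁ g μ lam) {μ' lam' : Ambient → ℝ}
    (hT' : HasStressEnergy t₀ t₁ r₀ r₁ g μ' lam') {x : Ambient}
    (hx : x ∈ spaceTime t₀ t₁ r₀ r₁) : μ x = μ' x ∧ lam x = lam' x := by
  have hcT : coordT x ∈ tangentR g x := (hg.mem_tangentR hr₀ hx).2 rfl
  have h0 : (0 : TangentSpace J x) ∈ tangentS x := mem_tangentS.2 rfl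
  have h0' : (0 : TangentSpace J x) ∈ tangentR g x := (hg.mem_tangentR hr₀ hx).2 rfl
  have hs : liftSphere x (EuclideanSpace.single 0 1) ∈ tangentS x := mem_tangentS.2 rfl
  have hA := (hg.pos_A _ hx).ne'
  have hr : radius x ≠ 0 := (pos_of_mem_openInterval hr₀ hx.2).ne'
  have h1 := (hT x hx _ hcT _ hcT _ h0 _ h0).symm.trans (hT' x hx _ hcT _ hcT _ h0 _ h0)
  have h2 := (hT x hx _ h0' _ h0' _ hs _ hs).symm.trans (hT' x hx _ h0' _ h0' _ hs _ hs)
  simp only [map_zero, mul_zero, add_zero, zero_add, hg.form x hx, dSigmaSq_apply] at h1 h2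
  simp [coordT, liftSphere, hA, hr] at h1 h2
  exact ⟨h1, h2⟩

theorem IsBlockMetric.exists_static (hg : IsBlockMetric t₀ t₁ r₀ r₁ g A B) (ht : t₀ < t₁)
    (hr₀ : 0 ≤ r₀) (hr : r₀ < r₁) (hT : HasStressEnergy t₀ t₁ r₀ r₁ g μ lam) :
    ∃ (m f : ℝ → ℝ) (c : ℝ), ∃ rs ∈ openInterval r₀ r₁, ContDiffOn ℝ ∞ m (openInterval r₀ r₁) ∧
      ContDiffOn ℝ ∞ f (openInterval t₀ t₁) ∧ IsBlockMetric t₀ t₁ r₀ r₁ g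
        (fun p => f p.1 * hFun m c rs p.2) (fun p => (hFun m c rs p.2)⁻¹) := by
  obtain ⟨ts, hts⟩ := exists_mem_openInterval ht
  obtain ⟨rs, hrs⟩ := exists_mem_openInterval hr
  have hopen := isOpen_rectangle t₀ t₁ r₀ r₁
  have hdA : ∀ p ∈ rectangle t₀ t₁ r₀ r₁, DifferentiableAt ℝ A p := fun p hp =>
    (hg.smooth_A.contDiffAt (hopen.mem_nhds hp)).differentiableAt (by simp)
  have hdB : ∀ p ∈ rectangle t₀ t₁ r₀ r₁, DifferentiableAt ℝ B p := fun p hp =>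
    (hg.smooth_B.contDiffAt (hopen.mem_nhds hp)).differentiableAt (by simp)
  have hBt : ∀ t ∈ openInterval t₀ t₁, ∀ r ∈ openInterval r₀ r₁, B (t, r) = B (ts, r) := by
    intro t ht r hr
    refine eq_of_hasDerivAt_zero (F := fun t => B (t, r)) (fun s hs => ?_) ht hts
    exact (hasDerivAt_fst_slice (hdB (s, r) ⟨hs, hr⟩)).congr_deriv
      (hT.grad_eq hg hr₀ ⟨hs, hr⟩).1
  have hABr : ∀ t ∈ openInterval t₀ t₁, ∀ r ∈ openInterval r₀ r₁,
      A (t, r) * B (t, r) = A (t, rs) * B (t, rs) := by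
    intro t ht r hr
    refine eq_of_hasDerivAt_zero (F := fun r => A (t, r) * B (t, r)) (fun s hs => ?_) hr hrs
    exact ((hasDerivAt_snd_slice (hdA (t, s) ⟨ht, hs⟩)).mul
      (hasDerivAt_snd_slice (hdB (t, s) ⟨ht, hs⟩))).congr_deriv (hT.grad_eq hg hr₀ ⟨ht, hs⟩).2
  set h : ℝ → ℝ := fun r => (B (ts, r))⁻¹ with hh
  have hhs : ContDiffOn ℝ ∞ h (openInterval r₀ r₁) :=
    (hg.smooth_B.comp (contDiff_const.prodMk contDiff_id).contDiffOn
      fun r hr => ⟨hts, hr⟩).inv fun r hr => (hg.pos_B _ ⟨hts, hr⟩).ne'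
  have hhs' : ContDiffOn ℝ ∞ (deriv h) (openInterval r₀ r₁) :=
    ((contDiffOn_infty_iff_deriv_of_isOpen (isOpen_openInterval _ _)).1 hhs).2
  have hden : ∀ r ∈ openInterval r₀ r₁, 8 * Real.pi * r ^ 2 ≠ 0 := fun r hr => by
    have := pos_of_mem_openInterval hr₀ hr
    positivity
  have hms : ContDiffOn ℝ ∞ (fun r => (1 - h r - r * deriv h r) / (8 * Real.pi * r ^ 2))
      (openInterval r₀ r₁) :=
    ((contDiffOn_const.sub hhs).sub (contDiffOn_id.mul hhs')).div
      (contDiff_const.mul (contDiff_id.pow 2)).contDiffOn hden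
  have hheq : ∀ r ∈ openInterval r₀ r₁,
      hFun (fun r => (1 - h r - r * deriv h r) / (8 * Real.pi * r ^ 2)) (rs * h rs - rs) rs r
        = h r :=
    fun r hr => hFun_eq hr₀ hhs (fun r hr => mul_div_cancel₀ _ (hden r hr)) hms hrs hr
  refine ⟨_, fun t => A (t, rs) * B (t, rs), rs * h rs - rs, rs, hrs, hms, ?_, hg.congr ?_ ?_⟩
  · exact (hg.smooth_A.mul hg.smooth_B).comp (contDiff_id.prodMk contDiff_const).contDiffOn
      fun t ht => ⟨ht, hrs⟩
  · intro p hp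
    have hB : B (ts, p.2) ≠ 0 := (hg.pos_B (ts, p.2) ⟨hts, hp.2⟩).ne'
    beta_reduce
    rw [hheq _ hp.2, ← hABr p.1 hp.1 p.2 hp.2, hBt p.1 hp.1 p.2 hp.2]
    exact mul_inv_cancel_right₀ hB _
  · intro p hp
    beta_reduce
    rw [hheq _ hp.2]
    exact (inv_inv _).trans (hBt p.1 hp.1 p.2 hp.2).symm

theorem hasStaticForm_of_isBlockMetric {f h F : ℝ → ℝ}
    (hg : IsBlockMetric t₀ t₁ r₀ r₁ g (fun p => f p.1 * h p.2) (fun p => (h p.2)⁻¹))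
    (hf : ∀ t ∈ openInterval t₀ t₁, 0 < f t)
    (hF : ∀ t ∈ openInterval t₀ t₁, HasDerivAt F (√(f t)) t) :
    HasStaticForm t₀ t₁ r₀ r₁ g h fun p => F p.1 := by
  intro x hx v w
  have h1 : ∀ v, dBase (fun p => F p.1) x v = √(f x.1.1) * v.1.1 := fun v => by
    have h := hasFDerivAt_comp_fst (hF _ hx.1)
    rw [dBase_apply _ _ h.differentiableAt, h.fderiv]
    rfl
  have h2 : ∀ v, dBase Prod.snd x v = v.1.2 := fun v => by
    rw [dBase_apply _ _ differentiableAt_snd, fderiv_snd]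
    rfl
  rw [hg.form x hx, h1, h1, h2, h2]
  have h3 := Real.mul_self_sqrt (hf _ hx.1).le
  simp only [radius]
  linear_combination h x.1.2 * v.1.1 * w.1.1 * h3

end Static

end SphericalSpacetime

end

theorem theorem1 (t₀ t₁ r₀ r₁ : EReal) (ht : t₀ < t₁) (hr₀ : 0 ≤ r₀) (hr : r₀ < r₁) :
    (∀ (g : MetricField) (μ lam : Ambient → ℝ),
      IsSphericallySymmetric t₀ t₁ r₀ r₁ g → HasStressEnergy t₀ t₁ r₀ r₁ g μ lam →
      ∃ m : ℝ → ℝ, ContDiffOn ℝ ∞ m (openInterval r₀ r₁) ∧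
        (∀ x ∈ spaceTime t₀ t₁ r₀ r₁, μ x = m (radius x)) ∧
        (∀ x ∈ spaceTime t₀ t₁ r₀ r₁,
          lam x = -m (radius x) - radius x / 2 * deriv m (radius x)) ∧
        ∃ c : ℝ, ∃ rs ∈ openInterval r₀ r₁,
          (∀ r ∈ openInterval r₀ r₁, massIntegral m rs r < (r + c) / 2) ∧
          ∃ (τ₀ τ₁ : EReal) (τ : ℝ × ℝ → ℝ), IsTimeCoordinate t₀ t₁ r₀ r₁ τ₀ τ₁ τ ∧
            HasStaticForm t₀ t₁ r₀ r₁ g (hFun m c rs) τ) ∧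
    (∀ (g : MetricField) (m : ℝ → ℝ) (c : ℝ), ContDiffOn ℝ ∞ m (openInterval r₀ r₁) →
      ∀ rs ∈ openInterval r₀ r₁,
        (∀ r ∈ openInterval r₀ r₁, massIntegral m rs r < (r + c) / 2) →
        HasStaticForm t₀ t₁ r₀ r₁ g (hFun m c rs) Prod.fst →
        IsSphericallySymmetric t₀ t₁ r₀ r₁ g ∧
          HasStressEnergy t₀ t₁ r₀ r₁ g (fun x => m (radius x))
            (fun x => -m (radius x) - radius x / 2 * deriv m (radius x))) := by
  constructor
  · intro g μ lam hg hT
    obtain ⟨A, B, hAB⟩ := hg.exists_isBlockMetric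
    obtain ⟨m, f, c, rs, hrs, hm, hf, hst⟩ := hAB.exists_static ht hr₀ hr hT
    obtain ⟨ts, hts⟩ := exists_mem_openInterval ht
    have hh : ∀ r ∈ openInterval r₀ r₁, 0 < hFun m c rs r := fun r hr =>
      inv_pos.1 (hst.pos_B (ts, r) ⟨hts, hr⟩)
    have hfpos : ∀ t ∈ openInterval t₀ t₁, 0 < f t := fun t ht =>
      (mul_pos_iff_of_pos_right (hh rs hrs)).1 (hst.pos_A (t, rs) ⟨ht, hrs⟩)
    have huniq := fun x (hx : x ∈ spaceTime t₀ t₁ r₀ r₁) =>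
      hT.unique hst hr₀ (hasStressEnergy_static hr₀ hm hrs hf hst) hx
    have hsqrt : ContDiffOn ℝ ∞ (fun t => √(f t)) (openInterval t₀ t₁) :=
      hf.sqrt fun t ht => (hfpos t ht).ne'
    have hF := fun t (ht : t ∈ openInterval t₀ t₁) => hasDerivAt_primitive hsqrt hts ht
    obtain ⟨τ₀, τ₁, hτ⟩ := exists_isTimeCoordinate r₀ r₁ hsqrt
      (fun t ht => Real.sqrt_pos.2 (hfpos t ht)) hF
    refine ⟨m, hm, fun x hx => (huniq x hx).1, fun x hx => (huniq x hx).2, c, rs, hrs,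
      fun r hr => ?_, τ₀, τ₁, _, hτ, hasStaticForm_of_isBlockMetric hst hfpos hF⟩
    have h1 := mul_pos (hh r hr) (pos_of_mem_openInterval hr₀ hr)
    have h2 := (pos_of_mem_openInterval hr₀ hr).ne'
    have h3 : hFun m c rs r * r = r + c - 2 * massIntegral m rs r := by
      rw [hFun]
      field_simp
    linarith
  · intro g m c hm rs hrs hc hg
    have hst := isBlockMetric_of_hasStaticForm hr₀ hm hrs hc hg
    exact ⟨hst.isSphericallySymmetric hr₀,
      hasStressEnergy_static hr₀ hm hrs contDiffOn_const hst⟩
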